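/- Write points of the closed half-space $\overline{\mathbb{R}^3_+}=\mathbb{R}^2\times[0,\infty)$ as $x=(x_2,x_3,y)$, and put $\rho=\sqrt{x_2^2+x_3^2+y^2}$, $\hat\rho=\sqrt{\rho^2+1}$. Let $\beta>0$ and let $f$ be a real-valued function, smooth on $\mathbb{R}^2\times[0,\infty)$ (up to the boundary), with $f=O(\rho^{-(4+2\beta)})$ uniformly as $\rho\to\infty$. For $t\in[0,1]$ consider the Dirichlet problem $$\Delta u-tu=f\ \text{ on } \mathbb{R}^2\times(0,\infty),\qquad u|_{y=0}=0 .$$ (i) For $t=0$ the problem has a solution $u$, smooth on $\mathbb{R}^2\times[0,\infty)$, which vanishes linearly and uniformly at the boundary, i.e. there are $C,\delta>0$ with $|u(x)|\le Cy$ whenever $0\le y\le\delta$, and which decays quadratically and uniformly at infinity, i.e. $u=O(\rho^{-2})$ uniformly as $\rho\to\infty$. (ii) For every $t\in(0,1]$ the problem has a solution $u$, smooth on $\mathbb{R}^2\times[0,\infty)$, which vanishes linearly and uniformly at the boundary in the same sense, and for which there is a constant $C_{f,t}$ (depending on $f$, its decay exponent $\beta$, and $t$, but not on $\beta'$) such that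 $$|u|\le C_{f,t}\,\hat\rho^{-(2+2\beta')}\quad\text{on }\mathbb{R}^2\times[0,\infty),\ \text{ for all } \beta'<\beta .$$ -/

import Mathlib

open scoped ContDiff

noncomputable section

namespace HalfSpace

/-- Euclidean three-space with coordinates `(x₂, x₃, y) = (x 0, x 1, x 2)`. -/
abbrev E3 : Type := EuclideanSpace ℝ (Fin 3)

/-- The closed half-space `ℝ² × [0, ∞)`. -/
def closedHalf : Set E3 := {x | 0 ≤ x 2}

/-- The open half-space `ℝ² × (0, ∞)`. -/
def openHalf : Set E3 := {x | 0 < x 2}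

/-- `ρ = √(x₂² + x₃² + y²)`. -/
def rho (x : E3) : ℝ := ‖x‖

/-- `ρ̂ = √(ρ² + 1)`. -/
def rhoHat (x : E3) : ℝ := Real.sqrt (rho x ^ 2 + 1)

/-- `g = O(ρ ^ (-s))` as `ρ → ∞`, uniformly over the closed half-space. -/
def DecaysAtInfinity (g : E3 → ℝ) (s : ℝ) : Prop :=
  ∃ C R : ℝ, 0 < R ∧ ∀ x ∈ closedHalf, R ≤ rho x → |g x| ≤ C * rho x ^ (-s)

/-- `u = O(y)` as `y → 0`, uniformly in `(x₂, x₃)`. -/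
def VanishesLinearly (u : E3 → ℝ) : Prop :=
  ∃ C δ : ℝ, 0 < δ ∧ ∀ x ∈ closedHalf, x 2 ≤ δ → |u x| ≤ C * x 2

/-- `u` is a solution, smooth up to the boundary, of `Δ u - t u = f` on the half-space with
`u = 0` on the boundary `y = 0`. Only the values of `u` and `f` on the closed half-space matter. -/
structure IsSmoothDirichletSolution (t : ℝ) (f u : E3 → ℝ) : Prop where
  smooth : ContDiffOn ℝ ∞ u closedHalf
  equation : ∀ x ∈ openHalf, Laplacian.laplacian u x - t * u x = f x
  boundary : ∀ x : E3, x 2 = 0 → u x = 0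

end HalfSpace

end

/-!
The solution is the potential of the odd extension of `f` in `y`, that is, its convolution with the
fundamental solution `-e^{-k‖z‖} / (4π‖z‖)` of `Δ - k²` on `ℝ³`, where `k² = t`. The potential is
odd, so it vanishes on the boundary plane, and it is Lipschitz, so it vanishes linearly there.

In the interior it is smooth by Weyl's lemma, which follows from a parametrix: a weak solution
coincides locally with its convolution with a smooth function. At the boundary the odd extension
jumps, but tangential derivatives still fall on the density, and the equation expresses the second
normal derivative through tangential ones, so that all derivatives extend continuously.

For `t > 0` the exponential decay of the kernel passes every power decay of the density on to the
potential. For `t = 0` oddness replaces the kernel by half its difference under reflection of `x`,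
which is `O(‖z‖ ‖x‖⁻²)` for `‖z‖ ≤ ‖x‖ / 2`: this gains one power over `‖x‖⁻¹`.
-/

noncomputable section

namespace HalfSpace

open MeasureTheory Set Filter Topology Metric Laplacian
open scoped Convolution

/-! ### Directional derivatives and the Laplacian -/

section Calculus

variable {E F : Type*} [NormedAddCommGroup E] [NormedAddCommGroup F] [NormedSpace ℝ F]

section NormedSpace

variable [NormedSpace ℝ E]

/-- The derivative of `f` in the direction `v`, as an operator on functions (so that it can be
iterated). It is read off the Fréchet derivative, hence is `0` where `f` is not differentiable. -/
def dirDeriv (v : E) (f : E → F) (x : E) : F := fderiv ℝ f x v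

variable {f g : E → F} {m n : WithTop ℕ∞} {x : E}

lemma hasDerivAt_comp_add_smul {D : F} {t : ℝ} {v : E}
    (h : HasLineDerivAt ℝ f D (x + t • v) v) : HasDerivAt (fun s : ℝ => f (x + s • v)) D t := by
  have hline : HasDerivAt (fun s : ℝ => f (x + t • v + s • v)) D (t - t) := by
    simpa only [sub_self, HasLineDerivAt] using h
  simpa [sub_smul, add_assoc] using hline.comp_sub_const t t

lemma contDiff_dirDeriv (hf : ContDiff ℝ n f) (hmn : m + 1 ≤ n) (v : E) :
    ContDiff ℝ m (dirDeriv v f) :=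
  (hf.fderiv_right hmn).clm_apply contDiff_const

lemma contDiffAt_dirDeriv (hf : ContDiffAt ℝ n f x) (hmn : m + 1 ≤ n) (v : E) :
    ContDiffAt ℝ m (dirDeriv v f) x :=
  (hf.fderiv_right hmn).clm_apply contDiffAt_const

lemma dirDeriv_congr (h : f =ᶠ[𝓝 x] g) (v : E) : dirDeriv v f =ᶠ[𝓝 x] dirDeriv v g :=
  (h.fderiv (𝕜 := ℝ)).mono fun z hz => by simp only [dirDeriv, hz]

lemma dirDeriv_comp_const_sub (f : E → F) (v a x : E) :
    dirDeriv v (fun z => f (a - z)) x = -dirDeriv v f (a - x) := by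
  have hneg := (ContinuousLinearEquiv.neg ℝ (M := E)).comp_right_fderiv
    (f := fun z => f (a + z)) (x := x)
  have hcomp : (fun z => f (a - z)) = (fun z => f (a + z)) ∘ ContinuousLinearEquiv.neg ℝ (M := E) :=
    funext fun z => by simp [sub_eq_add_neg]
  rw [dirDeriv, hcomp, hneg, fderiv_comp_add_left]
  simp [dirDeriv, sub_eq_add_neg]

lemma dirDeriv_dirDeriv_apply (hf : ContDiffAt ℝ 2 f x) (v w : E) :
    dirDeriv v (dirDeriv w f) x = fderiv ℝ (fderiv ℝ f) x v w := by
  have hd : DifferentiableAt ℝ (fderiv ℝ f) x :=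
    (hf.fderiv_right (m := 1) (by norm_num)).differentiableAt (by norm_num)
  change fderiv ℝ (fun z => fderiv ℝ f z w) x v = _
  rw [fderiv_clm_apply hd (differentiableAt_const _)]
  simp

lemma dirDeriv_comm (hf : ContDiffAt ℝ 2 f x) (v w : E) :
    dirDeriv v (dirDeriv w f) x = dirDeriv w (dirDeriv v f) x := by
  rw [dirDeriv_dirDeriv_apply hf, dirDeriv_dirDeriv_apply hf]
  exact hf.isSymmSndFDerivAt (by simp) v w

end NormedSpace

section InnerProductSpace

variable [InnerProductSpace ℝ E]

lemma dirDeriv_comp_norm_sq_add {φ : ℝ → ℝ} {c : ℝ} {x : E}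
    (hφ : DifferentiableAt ℝ φ (‖x‖ ^ 2 + c)) (v : E) :
    dirDeriv v (fun z => φ (‖z‖ ^ 2 + c)) x = 2 * inner ℝ x v * deriv φ (‖x‖ ^ 2 + c) := by
  have hcomp := hφ.hasDerivAt.comp_hasFDerivAt x
    ((hasStrictFDerivAt_norm_sq x).hasFDerivAt.add_const c)
  rw [dirDeriv, show (fun z => φ (‖z‖ ^ 2 + c)) = φ ∘ fun z => ‖z‖ ^ 2 + c from rfl, hcomp.fderiv]
  simp
  ring

lemma dirDeriv_dirDeriv_comp_norm_sq_add {φ : ℝ → ℝ} {c : ℝ} {x : E}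
    (hφ : ContDiffAt ℝ 2 φ (‖x‖ ^ 2 + c)) (v : E) :
    dirDeriv v (dirDeriv v (fun z => φ (‖z‖ ^ 2 + c))) x =
      4 * inner ℝ x v ^ 2 * deriv (deriv φ) (‖x‖ ^ 2 + c) +
        2 * ‖v‖ ^ 2 * deriv φ (‖x‖ ^ 2 + c) := by
  have hcont : ContinuousAt (fun z : E => ‖z‖ ^ 2 + c) x := by fun_prop
  have hfirst : dirDeriv v (fun z => φ (‖z‖ ^ 2 + c)) =ᶠ[𝓝 x]
      fun z => 2 * inner ℝ z v * deriv φ (‖z‖ ^ 2 + c) :=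
    (hcont.eventually (hφ.eventually (by simp))).mono fun z hz =>
      dirDeriv_comp_norm_sq_add (hz.differentiableAt (by simp)) v
  have hφ' : DifferentiableAt ℝ (deriv φ) (‖x‖ ^ 2 + c) :=
    (contDiffAt_dirDeriv (m := 1) hφ (by norm_num) 1).differentiableAt (by simp)
  have hinner : HasFDerivAt (fun z : E => 2 * inner ℝ z v) ((2 : ℝ) • innerSL ℝ v) x := by
    simpa [real_inner_comm v] using ((innerSL ℝ v : E →L[ℝ] ℝ).hasFDerivAt (x := x)).const_mul 2
  have hcomp := hφ'.hasDerivAt.comp_hasFDerivAt x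
    ((hasStrictFDerivAt_norm_sq x).hasFDerivAt.add_const c)
  rw [dirDeriv, hfirst.fderiv_eq]
  change fderiv ℝ ((fun z => 2 * inner ℝ z v) * (deriv φ ∘ fun z => ‖z‖ ^ 2 + c)) x v = _
  rw [(hinner.mul hcomp).fderiv]
  simp
  ring

variable [FiniteDimensional ℝ E]

lemma laplacian_eq_sum_dirDeriv {ι : Type*} [Fintype ι] (b : OrthonormalBasis ι ℝ E)
    {f : E → F} {x : E} (hf : ContDiffAt ℝ 2 f x) :
    Δ f x = ∑ i, dirDeriv (b i) (dirDeriv (b i) f) x := by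
  simp only [InnerProductSpace.laplacian_eq_iteratedFDeriv_orthonormalBasis f b,
    iteratedFDeriv_two_apply, dirDeriv_dirDeriv_apply hf, Matrix.cons_val_zero,
    Matrix.cons_val_one]

lemma contDiff_laplacian {f : E → F} {m n : WithTop ℕ∞} (hf : ContDiff ℝ n f) (hmn : m + 2 ≤ n) :
    ContDiff ℝ m (Δ f) := by
  have hmn' : m + 1 + 1 ≤ n := by rwa [add_assoc, one_add_one_eq_two]
  have hsum : Δ f = fun x => ∑ i, dirDeriv (stdOrthonormalBasis ℝ E i)
      (dirDeriv (stdOrthonormalBasis ℝ E i) f) x :=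
    funext fun x => laplacian_eq_sum_dirDeriv _ (hf.of_le (le_add_self.trans hmn)).contDiffAt
  rw [hsum]
  exact ContDiff.sum fun i _ => contDiff_dirDeriv (contDiff_dirDeriv hf hmn' _) le_rfl _

lemma hasCompactSupport_laplacian {f : E → F} (hf : HasCompactSupport f) :
    HasCompactSupport (Δ f) := by
  refine hf.mono' fun x hx => by_contra fun hx' => hx ?_
  have hzero : f =ᶠ[𝓝 x] fun _ => 0 := notMem_tsupport_iff_eventuallyEq.1 hx'
  rw [(InnerProductSpace.laplacian_congr_nhds hzero).self_of_nhds]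
  simp

lemma laplacian_comp_const_sub {f : E → F} (hf : ContDiff ℝ 2 f) (a x : E) :
    Δ (fun z => f (a - z)) x = Δ f (a - x) := by
  have hneg : ∀ v, dirDeriv v (fun z => f (a - z)) = -fun z => dirDeriv v f (a - z) :=
    fun v => funext fun z => dirDeriv_comp_const_sub f v a z
  rw [laplacian_eq_sum_dirDeriv (stdOrthonormalBasis ℝ E) (by fun_prop),
    laplacian_eq_sum_dirDeriv (stdOrthonormalBasis ℝ E) hf.contDiffAt]
  refine Finset.sum_congr rfl fun i _ => ?_
  rw [hneg, dirDeriv, fderiv_neg, neg_apply, ← dirDeriv,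
    dirDeriv_comp_const_sub, neg_neg]

/-- The operator `Δ - k²` of the Dirichlet problem with `t = k²`. -/
def screenedLaplacian (k : ℝ) (f : E → ℝ) (x : E) : ℝ := Δ f x - k ^ 2 * f x

lemma contDiff_screenedLaplacian {f : E → ℝ} {m n : WithTop ℕ∞} (hf : ContDiff ℝ n f)
    (hmn : m + 2 ≤ n) (k : ℝ) : ContDiff ℝ m (screenedLaplacian k f) :=
  (contDiff_laplacian hf hmn).sub
    (contDiff_const.mul (hf.of_le ((le_add_of_nonneg_right zero_le).trans hmn)))

lemma hasCompactSupport_screenedLaplacian {f : E → ℝ} (hf : HasCompactSupport f) (k : ℝ) :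
    HasCompactSupport (screenedLaplacian k f) :=
  (hasCompactSupport_laplacian hf).sub hf.mul_left

lemma screenedLaplacian_congr {f g : E → ℝ} {x : E} (h : f =ᶠ[𝓝 x] g) (k : ℝ) :
    screenedLaplacian k f x = screenedLaplacian k g x := by
  rw [screenedLaplacian, screenedLaplacian, h.eq_of_nhds,
    (InnerProductSpace.laplacian_congr_nhds h).eq_of_nhds]

lemma screenedLaplacian_comp_const_sub {f : E → ℝ} (hf : ContDiff ℝ 2 f) (k : ℝ) (a x : E) :
    screenedLaplacian k (fun z => f (a - z)) x = screenedLaplacian k f (a - x) := by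
  rw [screenedLaplacian, laplacian_comp_const_sub hf, screenedLaplacian]

lemma laplacian_comp_norm_sq_add {φ : ℝ → ℝ} {c : ℝ} {x : E}
    (hφ : ContDiffAt ℝ 2 φ (‖x‖ ^ 2 + c)) :
    Δ (fun z : E => φ (‖z‖ ^ 2 + c)) x =
      4 * ‖x‖ ^ 2 * deriv (deriv φ) (‖x‖ ^ 2 + c) +
        2 * Module.finrank ℝ E * deriv φ (‖x‖ ^ 2 + c) := by
  have hsmooth : ContDiffAt ℝ 2 (fun z : E => φ (‖z‖ ^ 2 + c)) x :=
    hφ.comp x ((contDiff_norm_sq ℝ).add contDiff_const).contDiffAt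
  rw [laplacian_eq_sum_dirDeriv (stdOrthonormalBasis ℝ E) hsmooth]
  simp only [dirDeriv_dirDeriv_comp_norm_sq_add hφ, OrthonormalBasis.norm_eq_one,
    Finset.sum_add_distrib, ← Finset.sum_mul, ← Finset.mul_sum]
  have hparseval := (stdOrthonormalBasis ℝ E).sum_sq_norm_inner_left x
  simp only [Real.norm_eq_abs, sq_abs] at hparseval
  rw [hparseval]
  simp [mul_comm (2 : ℝ)]

variable [MeasurableSpace E] [BorelSpace E] (μ : Measure E) [μ.IsAddHaarMeasure]
  {ψ g : E → ℝ}

lemma integral_mul_dirDeriv (hψ : ContDiff ℝ 1 ψ) (hg : ContDiff ℝ 1 g)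
    (hgc : HasCompactSupport g) (v : E) :
    ∫ z, ψ z * dirDeriv v g z ∂μ = -∫ z, dirDeriv v ψ z * g z ∂μ := by
  have hψ' : Continuous (dirDeriv v ψ) := (contDiff_dirDeriv (m := 0) hψ (by simp) v).continuous
  have hg' : Continuous (dirDeriv v g) := (contDiff_dirDeriv (m := 0) hg (by simp) v).continuous
  exact integral_mul_fderiv_eq_neg_fderiv_mul_of_integrable
    ((hψ'.mul hg.continuous).integrable_of_hasCompactSupport hgc.mul_left)
    ((hψ.continuous.mul hg').integrable_of_hasCompactSupport (hgc.fderiv_apply ℝ v).mul_left)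
    ((hψ.continuous.mul hg.continuous).integrable_of_hasCompactSupport hgc.mul_left)
    (fun x _ => hψ.differentiable (by simp) x) (fun x _ => hg.differentiable (by simp) x)

lemma integral_mul_laplacian (hψ : ContDiff ℝ 2 ψ) (hg : ContDiff ℝ 2 g)
    (hgc : HasCompactSupport g) :
    ∫ z, ψ z * Δ g z ∂μ = ∫ z, Δ ψ z * g z ∂μ := by
  set b := stdOrthonormalBasis ℝ E
  have hψ' : ∀ i, ContDiff ℝ 1 (dirDeriv (b i) ψ) := fun i =>
    contDiff_dirDeriv hψ (by norm_num) _
  have hg' : ∀ i, ContDiff ℝ 1 (dirDeriv (b i) g) := fun i =>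
    contDiff_dirDeriv hg (by norm_num) _
  have hψ'' : ∀ i, Continuous (dirDeriv (b i) (dirDeriv (b i) ψ)) := fun i =>
    (contDiff_dirDeriv (m := 0) (hψ' i) (by simp) _).continuous
  have hg'' : ∀ i, Continuous (dirDeriv (b i) (dirDeriv (b i) g)) := fun i =>
    (contDiff_dirDeriv (m := 0) (hg' i) (by simp) _).continuous
  simp only [laplacian_eq_sum_dirDeriv b hψ.contDiffAt, laplacian_eq_sum_dirDeriv b hg.contDiffAt,
    Finset.mul_sum, Finset.sum_mul]
  rw [integral_finsetSum, integral_finsetSum]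
  rotate_left
  · exact fun i _ => ((hψ'' i).mul hg.continuous).integrable_of_hasCompactSupport hgc.mul_left
  · exact fun i _ => (hψ.continuous.mul (hg'' i)).integrable_of_hasCompactSupport
      ((hgc.fderiv_apply ℝ (b i)).fderiv_apply ℝ (b i)).mul_left
  refine Finset.sum_congr rfl fun i _ => ?_
  rw [integral_mul_dirDeriv μ (hψ.of_le (by norm_num)) (hg' i) (hgc.fderiv_apply ℝ _),
    integral_mul_dirDeriv μ (hψ' i) (hg.of_le (by norm_num)) hgc, neg_neg]

lemma integral_mul_screenedLaplacian (hψ : ContDiff ℝ 2 ψ) (hg : ContDiff ℝ 2 g)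
    (hgc : HasCompactSupport g) (k : ℝ) :
    ∫ z, ψ z * screenedLaplacian k g z ∂μ = ∫ z, screenedLaplacian k ψ z * g z ∂μ := by
  have hψg : Integrable (fun z => k ^ 2 * (ψ z * g z)) μ :=
    ((hψ.continuous.mul hg.continuous).integrable_of_hasCompactSupport hgc.mul_left).const_mul _
  have hψΔ : Integrable (fun z => ψ z * Δ g z) μ :=
    (hψ.continuous.mul (contDiff_laplacian (m := 0) hg (by simp)).continuous
      ).integrable_of_hasCompactSupport (hasCompactSupport_laplacian hgc).mul_left
  have hΔg : Integrable (fun z => Δ ψ z * g z) μ :=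
    ((contDiff_laplacian (m := 0) hψ (by simp)).continuous.mul hg.continuous
      ).integrable_of_hasCompactSupport hgc.mul_left
  calc ∫ z, ψ z * screenedLaplacian k g z ∂μ
      = ∫ z, ψ z * Δ g z - k ^ 2 * (ψ z * g z) ∂μ := by
        congr 1 with z
        rw [screenedLaplacian]
        ring
    _ = ∫ z, Δ ψ z * g z - k ^ 2 * (ψ z * g z) ∂μ := by
        rw [integral_sub hψΔ hψg, integral_sub hΔg hψg, integral_mul_laplacian μ hψ hg hgc]
    _ = ∫ z, screenedLaplacian k ψ z * g z ∂μ := by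
        congr 1 with z
        rw [screenedLaplacian]
        ring

end InnerProductSpace

end Calculus

/-! ### Weakly singular kernels -/

section WeaklySingular

variable {E : Type*}

/-- Bounded integrable densities: those whose convolution with a weakly singular kernel
converges absolutely at every point. -/
structure BoundedIntegrable [MeasureSpace E] (H : E → ℝ) : Prop where
  integrable : Integrable H
  bounded : ∃ M, ∀ z, |H z| ≤ M

lemma BoundedIntegrable.of_hasCompactSupport [TopologicalSpace E] [MeasureSpace E]
    [OpensMeasurableSpace E] [IsFiniteMeasureOnCompacts (volume : Measure E)] {H : E → ℝ}
    (hH : Continuous H) (hc : HasCompactSupport H) : BoundedIntegrable H :=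
  ⟨hH.integrable_of_hasCompactSupport hc, hc.exists_bound_of_continuous hH⟩

lemma BoundedIntegrable.sub [MeasureSpace E] {H H' : E → ℝ} (hH : BoundedIntegrable H)
    (hH' : BoundedIntegrable H') : BoundedIntegrable (H - H') := by
  obtain ⟨M, hM⟩ := hH.bounded
  obtain ⟨M', hM'⟩ := hH'.bounded
  exact ⟨hH.integrable.sub hH'.integrable,
    M + M', fun z => (abs_sub _ _).trans (add_le_add (hM z) (hM' z))⟩

variable [NormedAddCommGroup E]

lemma inv_norm_pow_mul_le {s : ℕ} {H : E → ℝ} {M : ℝ} (hM : ∀ z, |H z| ≤ M) (w z : E) :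
    ‖w‖⁻¹ ^ s * |H z| ≤ (ball (0 : E) 1).indicator (fun w => ‖w‖⁻¹ ^ s) w * M + |H z| := by
  by_cases hw : w ∈ ball (0 : E) 1
  · rw [indicator_of_mem hw]
    exact (mul_le_mul_of_nonneg_left (hM z) (by positivity)).trans
      (le_add_of_nonneg_right (abs_nonneg _))
  · have hw' : 1 ≤ ‖w‖ := by simpa using hw
    rw [indicator_of_notMem hw, zero_mul, zero_add]
    exact mul_le_of_le_one_left (abs_nonneg _)
      (pow_le_one₀ (by positivity) (inv_le_one_of_one_le₀ hw'))

variable [NormedSpace ℝ E] [MeasureSpace E] [BorelSpace E] {s : ℕ} {H K : E → ℝ}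

/-- A kernel with singularity of order `s` below the dimension. The bound is required at the
origin as well, where it forces `K 0 = 0` when `0 < s`, because of `0⁻¹ = 0`. -/
structure WeaklySingular (s : ℕ) (K : E → ℝ) : Prop where
  lt_finrank : s < Module.finrank ℝ E
  measurable : Measurable K
  abs_le : ∀ z, |K z| ≤ ‖z‖⁻¹ ^ s

lemma weaklySingular_inv_norm_pow (hs : s < Module.finrank ℝ E) :
    WeaklySingular s fun z : E => ‖z‖⁻¹ ^ s :=
  ⟨hs, by fun_prop, fun z => (abs_of_nonneg (by positivity)).le⟩

variable [FiniteDimensional ℝ E] [(volume : Measure E).IsAddHaarMeasure]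

lemma boundedIntegrable_of_abs_le_rpow {p C : ℝ} (hp : Module.finrank ℝ E < p)
    (hm : AEStronglyMeasurable H) (hC : ∀ z, |H z| ≤ C * (1 + ‖z‖) ^ (-p)) :
    BoundedIntegrable H := by
  have hC0 : 0 ≤ C := by simpa using (abs_nonneg _).trans (hC 0)
  have hp0 : 0 ≤ p := (Nat.cast_nonneg _).trans hp.le
  refine ⟨((integrable_one_add_norm hp).const_mul C).mono' hm (Eventually.of_forall hC), C,
    fun z => (hC z).trans (mul_le_of_le_one_right hC0 (Real.rpow_le_one_of_one_le_of_nonpos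
      (le_add_of_nonneg_right (norm_nonneg z)) (neg_nonpos.2 hp0)))⟩

lemma WeaklySingular.locallyIntegrable (hK : WeaklySingular s K) : LocallyIntegrable K :=
  locallyIntegrable_of_norm_le_rpow (C := 1) (α := s) (by have := hK.lt_finrank; lia)
    (by exact_mod_cast hK.lt_finrank)
    (Eventually.of_forall fun z => by simpa [Real.rpow_neg] using hK.abs_le z)
    hK.measurable.aestronglyMeasurable

lemma integrable_indicator_inv_norm_pow (hs : s < Module.finrank ℝ E) :
    Integrable ((ball (0 : E) 1).indicator fun w => ‖w‖⁻¹ ^ s) :=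
  (integrable_indicator_iff measurableSet_ball).2
    (((weaklySingular_inv_norm_pow hs).locallyIntegrable.integrableOn_isCompact
      (isCompact_closedBall 0 1)).mono_set ball_subset_closedBall)

lemma integrable_inv_norm_pow_mul (hs : s < Module.finrank ℝ E) (hH : BoundedIntegrable H)
    (x : E) : Integrable fun z => ‖x - z‖⁻¹ ^ s * |H z| := by
  obtain ⟨M, hM⟩ := hH.bounded
  refine ((((integrable_indicator_inv_norm_pow hs).comp_sub_left x).mul_const M).add
    hH.integrable.abs).mono' ?_ (Eventually.of_forall fun z => ?_)
  · exact (Measurable.aestronglyMeasurable (by fun_prop)).mul hH.integrable.abs.1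
  · rw [Real.norm_of_nonneg (by positivity)]
    exact inv_norm_pow_mul_le hM _ _

lemma exists_integral_inv_norm_pow_mul_le (hs : s < Module.finrank ℝ E)
    (hH : BoundedIntegrable H) : ∃ C, ∀ x, ∫ z, ‖x - z‖⁻¹ ^ s * |H z| ≤ C := by
  obtain ⟨M, hM⟩ := hH.bounded
  set J : E → ℝ := (ball (0 : E) 1).indicator fun w => ‖w‖⁻¹ ^ s
  have hJ : ∀ x, Integrable fun z => J (x - z) * M := fun x =>
    ((integrable_indicator_inv_norm_pow hs).comp_sub_left x).mul_const M
  refine ⟨(∫ w, J w) * M + ∫ z, |H z|, fun x => ?_⟩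
  rw [← integral_sub_left_eq_self J volume x, ← integral_mul_const,
    ← integral_add (hJ x) hH.integrable.abs]
  exact integral_mono (integrable_inv_norm_pow_mul hs hH x) ((hJ x).add hH.integrable.abs)
    fun z => inv_norm_pow_mul_le hM _ _

lemma WeaklySingular.integrable_mul (hK : WeaklySingular s K) (hH : BoundedIntegrable H) (x : E) :
    Integrable fun z => H z * K (x - z) := by
  refine (integrable_inv_norm_pow_mul hK.lt_finrank hH x).mono'
    (hH.integrable.1.mul (hK.measurable.comp (by fun_prop)).aestronglyMeasurable)
    (Eventually.of_forall fun z => ?_)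
  rw [norm_mul, mul_comm]
  exact mul_le_mul_of_nonneg_right (hK.abs_le _) (abs_nonneg _)

lemma WeaklySingular.exists_integral_abs_mul_le (hK : WeaklySingular s K)
    (hH : BoundedIntegrable H) : ∃ C, ∀ x, ∫ z, |H z * K (x - z)| ≤ C := by
  obtain ⟨C, hC⟩ := exists_integral_inv_norm_pow_mul_le hK.lt_finrank hH
  refine ⟨C, fun x => (integral_mono (hK.integrable_mul hH x).abs
    (integrable_inv_norm_pow_mul hK.lt_finrank hH x) fun z => ?_).trans (hC x)⟩
  simp only [abs_mul, mul_comm |H z|]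
  exact mul_le_mul_of_nonneg_right (hK.abs_le _) (abs_nonneg _)

lemma WeaklySingular.integral_convolution_mul_eq (hK : WeaklySingular s K)
    (hsymm : ∀ z, K (-z) = K z) (hH : BoundedIntegrable H) {ψ : E → ℝ}
    (hψ : BoundedIntegrable ψ) : ∫ x, (H ⋆ K) x * ψ x = ∫ z, H z * (ψ ⋆ K) z := by
  have hflip : ∀ x z, K (z - x) = K (x - z) := fun x z => by rw [← hsymm, neg_sub]
  obtain ⟨C, hC⟩ := hK.exists_integral_abs_mul_le hψ
  have hmeas : AEStronglyMeasurable (Function.uncurry fun x z => H z * (ψ x * K (z - x)))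
      (volume.prod volume) :=
    hH.integrable.1.comp_snd.mul (hψ.integrable.1.comp_fst.mul
      (hK.measurable.comp (measurable_snd.sub measurable_fst)).aestronglyMeasurable)
  have hint : Integrable (Function.uncurry fun x z => H z * (ψ x * K (z - x)))
      (volume.prod volume) := by
    refine (integrable_prod_iff' hmeas).2
      ⟨Eventually.of_forall fun z => by
        simpa only [Function.uncurry_apply_pair] using (hK.integrable_mul hψ z).const_mul (H z),
        ?_⟩
    refine (hH.integrable.abs.mul_const C).mono' hmeas.prod_swap.norm.integral_prod_right'
      (Eventually.of_forall fun z => ?_)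
    simp only [Function.uncurry_apply_pair, norm_mul (H z), integral_const_mul]
    rw [norm_mul, norm_norm, Real.norm_of_nonneg (integral_nonneg fun x => norm_nonneg _)]
    exact mul_le_mul_of_nonneg_left (hC z) (abs_nonneg _)
  simp only [convolution_lsmul, smul_eq_mul, ← integral_const_mul]
  rw [← integral_integral_swap hint]
  congr 1 with x
  rw [← integral_mul_const]
  congr 1 with z
  rw [hflip x z]
  ring

lemma WeaklySingular.exists_lipschitzWith_convolution (hK : WeaklySingular s K)
    (hs : s + 1 < Module.finrank ℝ E) {A : ℝ}
    (hK' : ∀ v w, v ≠ 0 → w ≠ 0 →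
      |K v - K w| ≤ A * ‖v - w‖ * (‖v‖⁻¹ ^ (s + 1) + ‖w‖⁻¹ ^ (s + 1)))
    (hH : BoundedIntegrable H) : ∃ C, LipschitzWith C (H ⋆ K) := by
  have : Nontrivial E := Module.nontrivial_of_finrank_pos (R := ℝ) (by lia)
  obtain ⟨C, hC⟩ := exists_integral_inv_norm_pow_mul_le hs hH
  have hint := integrable_inv_norm_pow_mul hs hH
  refine ⟨(|A| * (C + C)).toNNReal, LipschitzWith.of_dist_le_mul fun x y => ?_⟩
  have hC0 : 0 ≤ C := (integral_nonneg fun z => by positivity).trans (hC 0)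
  rw [Real.coe_toNNReal _ (by positivity), dist_eq_norm, dist_eq_norm]
  simp only [convolution_lsmul, smul_eq_mul]
  rw [← integral_sub (hK.integrable_mul hH x) (hK.integrable_mul hH y)]
  calc ‖∫ z, H z * K (x - z) - H z * K (y - z)‖
      ≤ ∫ z, |A| * ‖x - y‖ * (‖x - z‖⁻¹ ^ (s + 1) * |H z| + ‖y - z‖⁻¹ ^ (s + 1) * |H z|) := by
        refine norm_integral_le_of_norm_le (((hint x).add (hint y)).const_mul _) ?_
        filter_upwards [Measure.ae_ne volume x, Measure.ae_ne volume y] with z hx hy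
        have hz := hK' _ _ (sub_ne_zero.2 hx.symm) (sub_ne_zero.2 hy.symm)
        rw [sub_sub_sub_cancel_right] at hz
        rw [← mul_sub, norm_mul, Real.norm_eq_abs, Real.norm_eq_abs, ← add_mul, ← mul_assoc,
          mul_comm]
        refine mul_le_mul_of_nonneg_right (hz.trans ?_) (abs_nonneg _)
        gcongr
        exact le_abs_self A
    _ = |A| * ‖x - y‖ *
        ((∫ z, ‖x - z‖⁻¹ ^ (s + 1) * |H z|) + ∫ z, ‖y - z‖⁻¹ ^ (s + 1) * |H z|) := by
        rw [integral_const_mul, integral_add (hint x) (hint y)]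
    _ ≤ |A| * ‖x - y‖ * (C + C) := by gcongr <;> exact hC _
    _ = |A| * (C + C) * ‖x - y‖ := by ring

lemma WeaklySingular.hasLineDerivAt_convolution (hK : WeaklySingular s K)
    (hH : BoundedIntegrable H) {H' : E → ℝ} (hH' : BoundedIntegrable H') {R : ℝ}
    (hR : ∀ z, R < ‖z‖ → H' z = 0) {v : E} (hd : ∀ z, HasLineDerivAt ℝ H (H' z) z v) (x : E) :
    HasLineDerivAt ℝ (H ⋆ K) ((H' ⋆ K) x) x v := by
  obtain ⟨M, hM⟩ := hH'.bounded
  have hmeas : ∀ {F : E → ℝ}, BoundedIntegrable F → ∀ t : ℝ,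
      AEStronglyMeasurable fun z => F (x + t • v - z) * K z := fun hF t =>
    (hF.integrable.comp_sub_left _).1.mul hK.measurable.aestronglyMeasurable
  have hbound : ∀ z, ∀ t ∈ ball (0 : ℝ) 1, ‖H' (x + t • v - z) * K z‖ ≤
      (closedBall x (R + ‖v‖)).indicator (fun z => M * ‖K z‖) z := fun z t ht => by
    by_cases hz : z ∈ closedBall x (R + ‖v‖)
    · rw [indicator_of_mem hz, norm_mul]
      exact mul_le_mul_of_nonneg_right (hM _) (norm_nonneg _)
    · have hfar : R < ‖x + t • v - z‖ := by
        have htv : ‖t • v‖ ≤ ‖v‖ := by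
          rw [norm_smul]
          exact mul_le_of_le_one_left (norm_nonneg v) (by simpa using (mem_ball.1 ht).le)
        have hxz : R + ‖v‖ < ‖x - z‖ := by
          rw [norm_sub_rev]
          simpa [dist_eq_norm] using hz
        have htri : ‖x - z‖ ≤ ‖x + t • v - z‖ + ‖t • v‖ := by
          simpa [add_sub_right_comm] using norm_sub_le (x + t • v - z) (t • v)
        linarith
      rw [indicator_of_notMem hz, hR _ hfar, zero_mul, norm_zero]
  have hboundInt : Integrable ((closedBall x (R + ‖v‖)).indicator fun z => M * ‖K z‖) :=
    (integrable_indicator_iff measurableSet_closedBall).2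
      ((hK.locallyIntegrable.integrableOn_isCompact (isCompact_closedBall _ _)).norm.const_mul M)
  have hderiv : ∀ z, ∀ t ∈ ball (0 : ℝ) 1, HasDerivAt (fun t : ℝ => H (x + t • v - z) * K z)
      (H' (x + t • v - z) * K z) t := fun z t _ => by
    have hline := (hasDerivAt_comp_add_smul (hd (x - z + t • v))).mul_const (K z)
    simpa only [add_sub_right_comm] using hline
  have hint : Integrable fun z => H (x + (0 : ℝ) • v - z) * K z := by
    simpa using (hK.integrable_mul hH x).comp_sub_left x
  have key := (hasDerivAt_integral_of_dominated_loc_of_deriv_le (ball_mem_nhds 0 one_pos)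
    (Eventually.of_forall (hmeas hH)) hint (hmeas hH' 0) (Eventually.of_forall hbound) hboundInt
    (Eventually.of_forall hderiv)).2
  simpa only [HasLineDerivAt, convolution_lsmul_swap, smul_eq_mul, zero_smul, add_zero] using key

end WeaklySingular

/-! ### The Yukawa kernel -/

/-- The function `φ` for which `φ(‖z‖²)` is the unnormalised Yukawa kernel `e^{-k‖z‖}/‖z‖`. In the
variable `‖z‖²` the kernel can be regularised to `φ(‖z‖² + c)`, which is smooth for `c > 0`. -/
def yukawaProfile (k w : ℝ) : ℝ := Real.exp (-k * √w) / √w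

/-- The fundamental solution of `Δ - k²` on `ℝ³`; for `k = 0` it is the Newtonian kernel. -/
def yukawa (k : ℝ) (z : E3) : ℝ := -(4 * Real.pi)⁻¹ * (Real.exp (-k * ‖z‖) / ‖z‖)

lemma yukawa_eq_yukawaProfile (k : ℝ) (z : E3) :
    yukawa k z = -(4 * Real.pi)⁻¹ * yukawaProfile k (‖z‖ ^ 2) := by
  simp [yukawa, yukawaProfile]

section Profile

variable {k w : ℝ}

lemma yukawaProfile_nonneg : 0 ≤ yukawaProfile k w := by
  unfold yukawaProfile; positivity

lemma yukawaProfile_norm_sq_add_le {E : Type*} [NormedAddCommGroup E] {c : ℝ} (hk : 0 ≤ k)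
    (hc : 0 ≤ c) {z : E} (hz : z ≠ 0) : yukawaProfile k (‖z‖ ^ 2 + c) ≤ ‖z‖⁻¹ := by
  have hroot : ‖z‖ ≤ √(‖z‖ ^ 2 + c) := Real.le_sqrt_of_sq_le (by linarith)
  rw [yukawaProfile, inv_eq_one_div]
  refine div_le_div₀ zero_le_one ?_ (norm_pos_iff.2 hz) hroot
  rw [Real.exp_le_one_iff, neg_mul]
  exact neg_nonpos.2 (by positivity)

lemma hasDerivAt_yukawaProfile (hw : 0 < w) :
    HasDerivAt (yukawaProfile k) (-(Real.exp (-k * √w) * (1 + k * √w)) / (2 * √w ^ 3)) w := by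
  have hs : 0 < √w := Real.sqrt_pos.2 hw
  have hroot := Real.hasDerivAt_sqrt hw.ne'
  refine (((hroot.const_mul (-k)).exp).div hroot hs.ne').congr_deriv ?_
  field_simp
  ring

lemma deriv_deriv_yukawaProfile (hw : 0 < w) :
    deriv (deriv (yukawaProfile k)) w =
      Real.exp (-k * √w) * (3 + 3 * (k * √w) + (k * √w) ^ 2) / (4 * √w ^ 5) := by
  have hfirst : deriv (yukawaProfile k) =ᶠ[𝓝 w]
      fun r => -(Real.exp (-k * √r) * (1 + k * √r)) / (2 * √r ^ 3) :=
    (eventually_gt_nhds hw).mono fun r hr => (hasDerivAt_yukawaProfile hr).deriv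
  have hroot := Real.hasDerivAt_sqrt hw.ne'
  have hsecond := ((((hroot.const_mul (-k)).exp).mul ((hroot.const_mul k).const_add 1)).neg).div
    ((hroot.pow 3).const_mul 2) (by simp only [Pi.pow_apply]; positivity)
  rw [hfirst.deriv_eq]
  refine hsecond.deriv.trans ?_
  simp only [Pi.mul_apply, Pi.neg_apply, Pi.pow_apply]
  field_simp
  ring

lemma contDiffAt_yukawaProfile {n : WithTop ℕ∞} (hw : 0 < w) :
    ContDiffAt ℝ n (yukawaProfile k) w := by
  have hroot : ContDiffAt ℝ n (fun r => √r) w := contDiffAt_id.sqrt hw.ne'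
  exact ((contDiffAt_const.mul hroot).exp).div hroot (Real.sqrt_pos.2 hw).ne'

lemma yukawaProfile_ode (hw : 0 < w) :
    4 * w * deriv (deriv (yukawaProfile k)) w + 6 * deriv (yukawaProfile k) w =
      k ^ 2 * yukawaProfile k w := by
  rw [deriv_deriv_yukawaProfile hw, (hasDerivAt_yukawaProfile hw).deriv, yukawaProfile]
  have hs : 0 < √w := Real.sqrt_pos.2 hw
  have hsq : w = √w ^ 2 := (Real.sq_sqrt hw.le).symm
  generalize √w = s at *
  subst hsq
  field_simp
  ring

end Profile

section Normalization

lemma integrable_three_div_sqrt_pow :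
    Integrable fun w : E3 => 3 / √(‖w‖ ^ 2 + 1) ^ 5 := by
  refine ((integrable_rpow_neg_one_add_norm_sq (μ := (volume : Measure E3)) (r := 5)
    (by simp; norm_num)).const_mul 3).congr (Eventually.of_forall fun w => ?_)
  have hpos : (0 : ℝ) < 1 + ‖w‖ ^ 2 := by positivity
  simp only
  rw [neg_div, Real.rpow_neg hpos.le, Real.sqrt_eq_rpow, ← Real.rpow_mul_natCast (by positivity),
    add_comm, ← div_eq_mul_inv]
  norm_num

lemma hasDerivAt_pow_three_div_sqrt (r : ℝ) :
    HasDerivAt (fun r : ℝ => r ^ 3 / √(r ^ 2 + 1) ^ 3) (r ^ 2 * (3 / √(r ^ 2 + 1) ^ 5)) r := by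
  have hpos : 0 < r ^ 2 + 1 := by positivity
  have hs : 0 < √(r ^ 2 + 1) := Real.sqrt_pos.2 hpos
  have hroot := (((hasDerivAt_pow 2 r).add_const 1).sqrt hpos.ne').pow 3
  refine ((hasDerivAt_pow 3 r).div hroot (pow_pos hs 3).ne').congr_deriv ?_
  have hsq : √(r ^ 2 + 1) ^ 2 = r ^ 2 + 1 := Real.sq_sqrt hpos.le
  simp only [Pi.pow_apply]
  generalize √(r ^ 2 + 1) = s at *
  field_simp
  push_cast
  linear_combination 6 * r ^ 2 * s ^ 2 * hsq

lemma tendsto_pow_three_div_sqrt :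
    Tendsto (fun r : ℝ => r ^ 3 / √(r ^ 2 + 1) ^ 3) atTop (𝓝 1) := by
  have hlim : Tendsto (fun r : ℝ => 1 / √(1 + r⁻¹ ^ 2) ^ 3) atTop (𝓝 (1 / √(1 + 0 ^ 2) ^ 3)) :=
    (Continuous.tendsto (f := fun r : ℝ => 1 / √(1 + r ^ 2) ^ 3)
      (by fun_prop (disch := intros; positivity)) 0).comp tendsto_inv_atTop_zero
  simp only [ne_eq, OfNat.ofNat_ne_zero, not_false_eq_true, zero_pow, add_zero, Real.sqrt_one,
    one_pow, div_one] at hlim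
  refine hlim.congr' ((eventually_gt_atTop 0).mono fun r hr => ?_)
  have hroot : √(r ^ 2 + 1) = r * √(1 + r⁻¹ ^ 2) := by
    rw [show r ^ 2 + 1 = r ^ 2 * (1 + r⁻¹ ^ 2) by field_simp, Real.sqrt_mul (by positivity),
      Real.sqrt_sq hr.le]
  simp only [hroot]
  field_simp

/-- The normalisation of the kernel: the integrand is `-Δ (‖w‖² + 1)^(-1/2)`. -/
lemma integral_three_div_sqrt_pow : ∫ w : E3, 3 / √(‖w‖ ^ 2 + 1) ^ 5 = 4 * Real.pi := by
  have hradial : ∫ r in Ioi (0 : ℝ), r ^ 2 • (3 / √(r ^ 2 + 1) ^ 5) = 1 := by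
    simpa using integral_Ioi_of_hasDerivAt_of_nonneg'
      (a := 0) (fun r _ => hasDerivAt_pow_three_div_sqrt r) (fun r _ => by positivity)
      tendsto_pow_three_div_sqrt
  rw [integral_fun_norm_addHaar volume fun r : ℝ => 3 / √(r ^ 2 + 1) ^ 5,
    finrank_euclideanSpace_fin, hradial, Measure.real, EuclideanSpace.volume_ball_fin_three,
    ENNReal.toReal_mul, ENNReal.toReal_ofReal (by positivity)]
  simp
  ring

end Normalization

section FundamentalSolution

variable {k : ℝ} {g : E3 → ℝ}

lemma screenedLaplacian_yukawaProfile {c : ℝ} {x : E3} (hx : 0 < ‖x‖ ^ 2 + c) :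
    screenedLaplacian k (fun z : E3 => yukawaProfile k (‖z‖ ^ 2 + c)) x =
      -(4 * c * deriv (deriv (yukawaProfile k)) (‖x‖ ^ 2 + c)) := by
  rw [screenedLaplacian, laplacian_comp_norm_sq_add (contDiffAt_yukawaProfile hx),
    finrank_euclideanSpace_fin]
  push_cast
  linear_combination yukawaProfile_ode (k := k) hx

lemma integral_yukawaProfile_mul {c : ℝ} (hc : 0 < c) (hg : ContDiff ℝ 2 g)
    (hgc : HasCompactSupport g) :
    ∫ z, yukawaProfile k (‖z‖ ^ 2 + c) * screenedLaplacian k g z =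
      -∫ z, 4 * c * deriv (deriv (yukawaProfile k)) (‖z‖ ^ 2 + c) * g z := by
  have hpos : ∀ z : E3, 0 < ‖z‖ ^ 2 + c := fun z => by positivity
  have hψ : ContDiff ℝ 2 fun z : E3 => yukawaProfile k (‖z‖ ^ 2 + c) :=
    contDiff_iff_contDiffAt.2 fun z => (contDiffAt_yukawaProfile (hpos z)).comp z
      ((contDiff_norm_sq ℝ).add contDiff_const).contDiffAt
  rw [integral_mul_screenedLaplacian volume hψ hg hgc k, ← integral_neg]
  congr 1 with z
  rw [screenedLaplacian_yukawaProfile (hpos z), neg_mul]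

lemma tendsto_integral_yukawaProfile_mul (hk : 0 ≤ k) (hg : Continuous g)
    (hgc : HasCompactSupport g) :
    Tendsto (fun ε : ℝ => ∫ z, yukawaProfile k (‖z‖ ^ 2 + ε ^ 2) * g z) (𝓝[>] 0)
      (𝓝 (∫ z, yukawaProfile k (‖z‖ ^ 2) * g z)) := by
  have hdom := integrable_inv_norm_pow_mul (s := 1) (by simp)
    (BoundedIntegrable.of_hasCompactSupport hg hgc) 0
  refine tendsto_integral_filter_of_dominated_convergence (fun z => ‖z‖⁻¹ * ‖g z‖)
    (Eventually.of_forall fun ε => ?_) (Eventually.of_forall fun ε => ?_)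
    (by simpa using hdom) ?_
  · refine Measurable.aestronglyMeasurable (Measurable.mul ?_ hg.measurable)
    unfold yukawaProfile
    fun_prop
  · filter_upwards [Measure.ae_ne volume (0 : E3)] with z hz
    rw [norm_mul, Real.norm_of_nonneg yukawaProfile_nonneg]
    gcongr
    exact yukawaProfile_norm_sq_add_le hk (sq_nonneg ε) hz
  · filter_upwards [Measure.ae_ne volume (0 : E3)] with z hz
    have hz' : 0 < ‖z‖ ^ 2 := by positivity
    have hshift : Tendsto (fun ε : ℝ => ‖z‖ ^ 2 + ε ^ 2) (𝓝[>] 0) (𝓝 (‖z‖ ^ 2)) :=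
      tendsto_nhdsWithin_of_tendsto_nhds
        (Continuous.tendsto' (by fun_prop) _ _ (by simp))
    exact ((hasDerivAt_yukawaProfile hz').continuousAt.tendsto.comp hshift).mul_const _

/-- `yukawaDefect a r` for `a = kε`, `r = √(‖w‖² + 1)` is the error `4 ε² φ''` of the regularised
Yukawa kernel, rescaled by `ε`. It is an approximate identity of mass `4π` as `a → 0`. -/
def yukawaDefect (a r : ℝ) : ℝ :=
  Real.exp (-(a * r)) * (3 + 3 * (a * r) + (a * r) ^ 2) / r ^ 5

lemma yukawaDefect_le {a r : ℝ} (ha : 0 ≤ a) (hr : 0 ≤ r) : yukawaDefect a r ≤ 3 / r ^ 5 := by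
  unfold yukawaDefect
  gcongr
  have har : 0 ≤ a * r := by positivity
  rw [Real.exp_neg, inv_mul_le_iff₀ (Real.exp_pos _)]
  nlinarith [Real.quadratic_le_exp_of_nonneg har, sq_nonneg (a * r)]

lemma integral_deriv_deriv_yukawaProfile_mul {ε : ℝ} (hε : 0 < ε) :
    ∫ z : E3, 4 * ε ^ 2 * deriv (deriv (yukawaProfile k)) (‖z‖ ^ 2 + ε ^ 2) * g z =
      ∫ w : E3, yukawaDefect (k * ε) √(‖w‖ ^ 2 + 1) * g (ε • w) := by
  have hscale := Measure.integral_comp_smul (volume : Measure E3)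
    (fun z => 4 * ε ^ 2 * deriv (deriv (yukawaProfile k)) (‖z‖ ^ 2 + ε ^ 2) * g z) ε
  rw [finrank_euclideanSpace_fin, abs_of_pos (by positivity), smul_eq_mul, eq_comm,
    inv_mul_eq_iff_eq_mul₀ (by positivity), ← integral_const_mul] at hscale
  rw [hscale]
  congr 1 with w
  have hroot : √(‖ε • w‖ ^ 2 + ε ^ 2) = ε * √(‖w‖ ^ 2 + 1) := by
    rw [norm_smul, Real.norm_of_nonneg hε.le,
      show (ε * ‖w‖) ^ 2 + ε ^ 2 = ε ^ 2 * (‖w‖ ^ 2 + 1) by ring,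
      Real.sqrt_mul (by positivity), Real.sqrt_sq hε.le]
  rw [deriv_deriv_yukawaProfile (by positivity), hroot, yukawaDefect, neg_mul,
    ← mul_assoc k]
  field_simp

lemma tendsto_integral_yukawaDefect_mul (hk : 0 ≤ k) (hg : Continuous g)
    (hgc : HasCompactSupport g) :
    Tendsto (fun ε : ℝ => ∫ w : E3, yukawaDefect (k * ε) √(‖w‖ ^ 2 + 1) * g (ε • w)) (𝓝[>] 0)
      (𝓝 (4 * Real.pi * g 0)) := by
  rw [← integral_three_div_sqrt_pow, ← integral_mul_const]
  obtain ⟨M, hM⟩ := hgc.exists_bound_of_continuous hg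
  have hgm := hg.measurable
  refine tendsto_integral_filter_of_dominated_convergence (fun w => 3 / √(‖w‖ ^ 2 + 1) ^ 5 * M)
    (Eventually.of_forall fun ε => ?_) ?_ (integrable_three_div_sqrt_pow.mul_const M)
    (Eventually.of_forall fun w => ?_)
  · refine Measurable.aestronglyMeasurable ?_
    unfold yukawaDefect
    fun_prop
  · filter_upwards [eventually_mem_nhdsWithin] with ε hε
    refine Eventually.of_forall fun w => ?_
    have hkε : 0 ≤ k * ε := mul_nonneg hk (le_of_lt hε)
    rw [norm_mul, Real.norm_of_nonneg (by unfold yukawaDefect; positivity)]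
    exact mul_le_mul (yukawaDefect_le hkε (by positivity)) (hM _) (norm_nonneg _) (by positivity)
  · refine tendsto_nhdsWithin_of_tendsto_nhds (Continuous.tendsto' ?_ _ _ ?_)
    · unfold yukawaDefect
      fun_prop
    · simp [yukawaDefect]

theorem integral_yukawa_mul (hk : 0 ≤ k) (hg : ContDiff ℝ 2 g) (hgc : HasCompactSupport g) :
    ∫ z, yukawa k z * screenedLaplacian k g z = g 0 := by
  have hlim : ∫ z, yukawaProfile k (‖z‖ ^ 2) * screenedLaplacian k g z =
      -(4 * Real.pi * g 0) := by
    refine tendsto_nhds_unique (tendsto_integral_yukawaProfile_mul hk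
      (contDiff_screenedLaplacian (m := 0) hg (by simp) k).continuous
      (hasCompactSupport_screenedLaplacian hgc k))
      ((tendsto_integral_yukawaDefect_mul hk hg.continuous hgc).neg.congr' ?_)
    filter_upwards [eventually_mem_nhdsWithin] with ε hε
    rw [integral_yukawaProfile_mul (pow_pos hε 2) hg hgc, integral_deriv_deriv_yukawaProfile_mul hε]
  simp only [yukawa_eq_yukawaProfile, mul_assoc]
  rw [integral_const_mul, hlim]
  field_simp [Real.pi_pos.ne']

end FundamentalSolution

section YukawaBounds

variable {k : ℝ}

lemma yukawa_neg (z : E3) : yukawa k (-z) = yukawa k z := by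
  simp [yukawa]

lemma abs_yukawa (z : E3) : |yukawa k z| = (4 * Real.pi)⁻¹ * (Real.exp (-k * ‖z‖) / ‖z‖) := by
  rw [yukawa, abs_mul, abs_neg, abs_of_pos (by positivity), abs_of_nonneg (by positivity)]

lemma inv_four_pi_le_one : (4 * Real.pi)⁻¹ ≤ 1 :=
  inv_le_one_of_one_le₀ (by linarith [Real.pi_gt_three])

lemma abs_yukawa_le (k : ℝ) (z : E3) : |yukawa k z| ≤ Real.exp (-k * ‖z‖) / ‖z‖ := by
  rw [abs_yukawa]
  exact mul_le_of_le_one_left (by positivity) inv_four_pi_le_one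

lemma weaklySingular_yukawa (hk : 0 ≤ k) : WeaklySingular 1 (yukawa k) where
  lt_finrank := by simp
  measurable := by unfold yukawa; fun_prop
  abs_le z := by
    refine (abs_yukawa_le k z).trans ?_
    rw [pow_one, inv_eq_one_div]
    gcongr
    rw [Real.exp_le_one_iff, neg_mul]
    exact neg_nonpos.2 (by positivity)

lemma contDiffAt_yukawa {n : WithTop ℕ∞} {z : E3} (hz : z ≠ 0) : ContDiffAt ℝ n (yukawa k) z := by
  rw [funext (yukawa_eq_yukawaProfile k)]
  exact contDiffAt_const.mul ((contDiffAt_yukawaProfile (by positivity)).comp z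
    (contDiff_norm_sq ℝ).contDiffAt)

lemma screenedLaplacian_yukawa {z : E3} (hz : z ≠ 0) : screenedLaplacian k (yukawa k) z = 0 := by
  have hz' : 0 < ‖z‖ ^ 2 + 0 := by positivity
  have hprofile := screenedLaplacian_yukawaProfile (k := k) hz'
  have hsmooth : ContDiffAt ℝ 2 (fun z : E3 => yukawaProfile k (‖z‖ ^ 2 + 0)) z :=
    (contDiffAt_yukawaProfile hz').comp z ((contDiff_norm_sq ℝ).add contDiff_const).contDiffAt
  have heq : yukawa k = (-(4 * Real.pi)⁻¹) • fun z : E3 => yukawaProfile k (‖z‖ ^ 2 + 0) := by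
    funext z
    simp [yukawa_eq_yukawaProfile]
  rw [screenedLaplacian] at hprofile ⊢
  rw [heq, InnerProductSpace.laplacian_smul _ hsmooth]
  simp only [Pi.smul_apply, smul_eq_mul]
  linear_combination (-(4 * Real.pi)⁻¹) * hprofile

lemma exp_neg_mul_div_antitoneOn (hk : 0 ≤ k) :
    AntitoneOn (fun a : ℝ => Real.exp (-k * a) / a) (Ioi 0) := fun a (ha : 0 < a) b _ hab => by
  have : Real.exp (-k * b) ≤ Real.exp (-k * a) := by
    rw [Real.exp_le_exp, neg_mul, neg_mul]
    exact neg_le_neg (by gcongr)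
  dsimp only
  gcongr

/-- By convexity of `exp`, the difference quotient `(1 - e^{-ka})/a` is antitone. -/
lemma exp_neg_mul_div_sub_le {a b : ℝ} (ha : 0 < a) (hab : a ≤ b) :
    Real.exp (-k * a) / a - Real.exp (-k * b) / b ≤ a⁻¹ - b⁻¹ := by
  have hb : 0 < b := ha.trans_le hab
  have hconv := convexOn_exp.2 (mem_univ (-k * b)) (mem_univ (0 : ℝ))
    (show 0 ≤ a / b by positivity) (sub_nonneg.2 ((div_le_one hb).2 hab)) (by ring)
  rw [show (a / b) • (-k * b) + (1 - a / b) • (0 : ℝ) = -k * a by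
    simp only [smul_eq_mul]; field_simp; ring] at hconv
  simp only [Real.exp_zero, smul_eq_mul, mul_one] at hconv
  calc Real.exp (-k * a) / a - Real.exp (-k * b) / b
      ≤ (a / b * Real.exp (-k * b) + (1 - a / b)) / a - Real.exp (-k * b) / b := by gcongr
    _ = a⁻¹ - b⁻¹ := by field_simp; ring

lemma abs_yukawa_sub_le_abs_norm_sub (hk : 0 ≤ k) {v w : E3} (hv : v ≠ 0) (hw : w ≠ 0) :
    |yukawa k v - yukawa k w| ≤ |‖v‖ - ‖w‖| * (‖v‖⁻¹ * ‖w‖⁻¹) := by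
  wlog hle : ‖v‖ ≤ ‖w‖ generalizing v w
  · rw [abs_sub_comm, abs_sub_comm ‖v‖, mul_comm ‖v‖⁻¹]
    exact this hw hv (le_of_not_ge hle)
  have hv' : 0 < ‖v‖ := norm_pos_iff.2 hv
  have hw' : 0 < ‖w‖ := norm_pos_iff.2 hw
  have hanti := exp_neg_mul_div_antitoneOn hk hv' hw' hle
  calc |yukawa k v - yukawa k w|
      = (4 * Real.pi)⁻¹ * (Real.exp (-k * ‖v‖) / ‖v‖ - Real.exp (-k * ‖w‖) / ‖w‖) := by
        rw [yukawa, yukawa, ← mul_sub, abs_mul, abs_neg, abs_of_pos (by positivity),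
          abs_of_nonneg (sub_nonneg.2 hanti)]
    _ ≤ 1 * (‖v‖⁻¹ - ‖w‖⁻¹) := by
        exact mul_le_mul inv_four_pi_le_one (exp_neg_mul_div_sub_le hv' hle)
          (sub_nonneg.2 hanti) zero_le_one
    _ = |‖v‖ - ‖w‖| * (‖v‖⁻¹ * ‖w‖⁻¹) := by
        rw [abs_of_nonpos (sub_nonpos.2 hle)]
        field_simp
        ring

lemma abs_yukawa_sub_le (hk : 0 ≤ k) {v w : E3} (hv : v ≠ 0) (hw : w ≠ 0) :
    |yukawa k v - yukawa k w| ≤ 1 * ‖v - w‖ * (‖v‖⁻¹ ^ (1 + 1) + ‖w‖⁻¹ ^ (1 + 1)) := by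
  refine (abs_yukawa_sub_le_abs_norm_sub hk hv hw).trans ?_
  rw [one_mul]
  refine mul_le_mul (abs_norm_sub_norm_le v w) ?_ (by positivity) (norm_nonneg _)
  nlinarith [sq_nonneg (‖v‖⁻¹ - ‖w‖⁻¹), sq_nonneg (‖v‖⁻¹ + ‖w‖⁻¹)]

end YukawaBounds

/-! ### Interior regularity -/

section Convolution

variable {E : Type*} [NormedAddCommGroup E] [InnerProductSpace ℝ E] [FiniteDimensional ℝ E]
  [MeasureSpace E] [BorelSpace E] [(volume : Measure E).IsAddHaarMeasure] {f g h : E → ℝ}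

lemma convolution_swap (f g : E → ℝ) : f ⋆ g = g ⋆ f := by
  ext x
  rw [convolution_lsmul_swap, convolution_lsmul]
  simp only [smul_eq_mul, mul_comm]

lemma convolution_assoc_of_continuous (hf : LocallyIntegrable f) (hg : Continuous g)
    (hgc : HasCompactSupport g) (hh : Continuous h) (hhc : HasCompactSupport h) :
    (f ⋆ g) ⋆ h = f ⋆ (g ⋆ h) := by
  ext x
  have hgn : HasCompactSupport fun z => ‖g z‖ := hgc.norm
  refine convolution_assoc _ _ _ _ (fun a b c => mul_assoc a b c) hf.aestronglyMeasurable
    hg.aestronglyMeasurable hh.aestronglyMeasurable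
    (Eventually.of_forall (hgc.convolutionExists_right _ hf hg))
    (Eventually.of_forall (hhc.norm.convolutionExists_right _ hg.norm.locallyIntegrable hh.norm))
    ((hgn.convolution _ hhc.norm).convolutionExists_right _ (fun y => (hf y).norm)
      (hhc.norm.continuous_convolution_right _ hg.norm.locallyIntegrable hh.norm) x)

lemma dirDeriv_convolution (hf : LocallyIntegrable f) (hg : ContDiff ℝ 1 g)
    (hgc : HasCompactSupport g) (v : E) : dirDeriv v (f ⋆ g) = f ⋆ dirDeriv v g := by
  ext x
  rw [dirDeriv, (hgc.hasFDerivAt_convolution_right _ hf hg x).fderiv,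
    convolution_precompR_apply _ hf (hgc.fderiv ℝ) (hg.continuous_fderiv (by simp))]
  rfl

lemma laplacian_convolution (hf : LocallyIntegrable f) (hg : ContDiff ℝ 2 g)
    (hgc : HasCompactSupport g) : Δ (f ⋆ g) = f ⋆ Δ g := by
  set b := stdOrthonormalBasis ℝ E
  have hg' : ∀ i, ContDiff ℝ 1 (dirDeriv (b i) g) := fun i => contDiff_dirDeriv hg (by norm_num) _
  have hgc' : ∀ i, HasCompactSupport (dirDeriv (b i) g) := fun i => hgc.fderiv_apply ℝ _
  ext x
  rw [laplacian_eq_sum_dirDeriv b (hgc.contDiff_convolution_right _ hf hg).contDiffAt]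
  simp only [dirDeriv_convolution hf (hg.of_le one_le_two) hgc,
    dirDeriv_convolution hf (hg' _) (hgc' _), convolution_lsmul, smul_eq_mul,
    laplacian_eq_sum_dirDeriv b hg.contDiffAt, Finset.mul_sum]
  refine (integral_finsetSum _ fun i _ => ?_).symm
  exact ((hgc' i).fderiv_apply ℝ (b i)).convolutionExists_right (.lsmul ℝ ℝ) hf
    (contDiff_dirDeriv (m := 0) (hg' i) (by simp) _).continuous x

lemma screenedLaplacian_convolution (hf : LocallyIntegrable f) (hg : ContDiff ℝ 2 g)
    (hgc : HasCompactSupport g) (k : ℝ) :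
    screenedLaplacian k (f ⋆ g) = f ⋆ screenedLaplacian k g := by
  have hsplit : screenedLaplacian k g = Δ g - k ^ 2 • g := rfl
  ext x
  rw [screenedLaplacian, laplacian_convolution hf hg hgc, hsplit, convolution_lsmul (g := _ - _)]
  simp only [Pi.sub_apply, Pi.smul_apply, smul_eq_mul, mul_sub, mul_left_comm _ (k ^ 2)]
  rw [integral_sub, integral_const_mul]
  · rfl
  · exact (hasCompactSupport_laplacian hgc).convolutionExists_right (.lsmul ℝ ℝ) hf
      (contDiff_laplacian (m := 0) hg (by simp)).continuous x
  · exact Integrable.const_mul (hgc.convolutionExists_right (.lsmul ℝ ℝ) hf hg.continuous x) _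

lemma convolution_screenedLaplacian {f : E → ℝ} (hf : ContDiff ℝ 2 f) (hg : ContDiff ℝ 2 g)
    (hgc : HasCompactSupport g) (k : ℝ) :
    f ⋆ screenedLaplacian k g = screenedLaplacian k f ⋆ g := by
  ext x
  simp only [convolution_lsmul, smul_eq_mul, ← screenedLaplacian_comp_const_sub hg]
  exact integral_mul_screenedLaplacian volume hf (hg.comp (contDiff_const.sub contDiff_id))
    (hgc.comp_homeomorph (Homeomorph.subLeft x)) k

end Convolution

section Parametrix

variable {k : ℝ} {φ : E3 → ℝ}

lemma yukawa_convolution_screenedLaplacian (hk : 0 ≤ k) (hφ : ContDiff ℝ 2 φ)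
    (hφc : HasCompactSupport φ) : yukawa k ⋆ screenedLaplacian k φ = φ := by
  ext x
  simp only [convolution_lsmul, smul_eq_mul, ← screenedLaplacian_comp_const_sub hφ]
  rw [integral_yukawa_mul (g := fun z => φ (x - z)) hk (by fun_prop)
    (hφc.comp_homeomorph (Homeomorph.subLeft x)), sub_zero]

variable (χ : ContDiffBump (0 : E3))

/-- A parametrix of `Δ - k²`: the fundamental solution, localised near its singularity. -/
def parametrix (k : ℝ) (z : E3) : ℝ := χ z * yukawa k z

/-- The smooth remainder `yukawa k - parametrix χ k`. -/
def yukawaTail (k : ℝ) (z : E3) : ℝ := (1 - χ z) * yukawa k z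

/-- The error of the parametrix: `(Δ - k²) (parametrix χ k)` is the Dirac mass at the origin minus
this smooth function of compact support. -/
def parametrixError (k : ℝ) : E3 → ℝ := screenedLaplacian k (yukawaTail χ k)

lemma contDiff_yukawaTail {n : ℕ∞} : ContDiff ℝ n (yukawaTail χ k) := by
  refine contDiff_iff_contDiffAt.2 fun z => ?_
  rcases eq_or_ne z 0 with rfl | hz
  · refine contDiffAt_const (c := (0 : ℝ)).congr_of_eventuallyEq ?_
    filter_upwards [χ.eventuallyEq_one] with w hw
    simp [yukawaTail, hw]
  · exact (contDiffAt_const.sub χ.contDiffAt).mul (contDiffAt_yukawa hz)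

lemma contDiff_parametrixError {n : ℕ∞} : ContDiff ℝ n (parametrixError χ k) :=
  contDiff_screenedLaplacian (n := (n + 2 : ℕ∞)) (contDiff_yukawaTail χ) (by simp) k

lemma tsupport_parametrixError_subset :
    tsupport (parametrixError χ k) ⊆ closedBall 0 χ.rOut := by
  refine closure_minimal (fun z hz => by_contra fun hz' => hz ?_) isClosed_closedBall
  have hz0 : z ≠ 0 := fun h => hz' (by simp [h, χ.rOut_pos.le])
  have htail : yukawaTail χ k =ᶠ[𝓝 z] yukawa k := by
    filter_upwards [isClosed_closedBall.isOpen_compl.mem_nhds hz'] with w hw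
    rw [yukawaTail, χ.zero_of_le_dist
      (by simpa using (not_le.1 (mt mem_closedBall.2 hw)).le), sub_zero, one_mul]
  rw [parametrixError, screenedLaplacian_congr htail, screenedLaplacian_yukawa hz0]

lemma hasCompactSupport_parametrixError : HasCompactSupport (parametrixError χ k) :=
  HasCompactSupport.of_support_subset_isCompact (isCompact_closedBall 0 χ.rOut)
    (subset_closure.trans (tsupport_parametrixError_subset χ))

lemma locallyIntegrable_yukawa (hk : 0 ≤ k) : LocallyIntegrable (yukawa k) :=
  (weaklySingular_yukawa hk).locallyIntegrable

lemma parametrix_add_yukawaTail : parametrix χ k + yukawaTail χ k = yukawa k := by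
  ext z
  simp only [Pi.add_apply, parametrix, yukawaTail]
  ring

lemma locallyIntegrable_parametrix (hk : 0 ≤ k) : LocallyIntegrable (parametrix χ k) := by
  rw [eq_sub_of_add_eq (parametrix_add_yukawaTail χ)]
  exact (locallyIntegrable_yukawa hk).sub
    (contDiff_yukawaTail (n := 0) χ).continuous.locallyIntegrable

lemma parametrix_convolution_screenedLaplacian (hk : 0 ≤ k) (hφ : ContDiff ℝ 2 φ)
    (hφc : HasCompactSupport φ) :
    parametrix χ k ⋆ screenedLaplacian k φ = φ - parametrixError χ k ⋆ φ := by
  have hLφ : Continuous (screenedLaplacian k φ) :=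
    (contDiff_screenedLaplacian (m := 0) hφ (by simp) k).continuous
  have hLφc := hasCompactSupport_screenedLaplacian hφc k
  have hsplit := ConvolutionExists.add_distrib (L := .lsmul ℝ ℝ)
    (hLφc.convolutionExists_right (.lsmul ℝ ℝ) (locallyIntegrable_parametrix χ hk) hLφ)
    (hLφc.convolutionExists_right (.lsmul ℝ ℝ)
      (contDiff_yukawaTail (k := k) (n := 0) χ).continuous.locallyIntegrable hLφ)
  rw [eq_sub_iff_add_eq, parametrixError,
    ← convolution_screenedLaplacian (contDiff_yukawaTail (n := 2) χ) hφ hφc, ← hsplit,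
    parametrix_add_yukawaTail, yukawa_convolution_screenedLaplacian hk hφ hφc]

end Parametrix

section WeylLemma

variable {k : ℝ} {U : Set E3} {w : E3 → ℝ}

/-- `w` solves `Δ w - k² w = 0` on `U` in the sense of distributions. -/
def IsWeaklyScreenedHarmonicOn (k : ℝ) (w : E3 → ℝ) (U : Set E3) : Prop :=
  ∀ φ : E3 → ℝ, ContDiff ℝ ∞ φ → HasCompactSupport φ → tsupport φ ⊆ U →
    ∫ z, w z * screenedLaplacian k φ z = 0

lemma tsupport_comp_const_sub_subset {E : Type*} [SeminormedAddCommGroup E] {f : E → ℝ} {r : ℝ}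
    (hf : tsupport f ⊆ closedBall 0 r) (x : E) :
    tsupport (fun z => f (x - z)) ⊆ closedBall x r := by
  refine closure_minimal (fun z hz => ?_) isClosed_closedBall
  simpa [dist_comm z x, dist_eq_norm] using hf (subset_tsupport f hz)

lemma screenedLaplacian_parametrix_convolution (χ : ContDiffBump (0 : E3)) (hk : 0 ≤ k)
    {φ : E3 → ℝ} (hφ : ContDiff ℝ 2 φ) (hφc : HasCompactSupport φ) :
    screenedLaplacian k (parametrix χ k ⋆ φ) = φ - parametrixError χ k ⋆ φ := by
  rw [screenedLaplacian_convolution (locallyIntegrable_parametrix χ hk) hφ hφc,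
    parametrix_convolution_screenedLaplacian χ hk hφ hφc]

lemma tsupport_parametrix_convolution_subset (χ φ : ContDiffBump (0 : E3)) :
    tsupport (parametrix χ k ⋆ φ.normed volume) ⊆ closedBall 0 (χ.rOut + φ.rOut) := by
  have hsupport : Function.support (parametrix χ k) ⊆ ball 0 χ.rOut :=
    (Function.support_mul_subset_left _ _).trans χ.support_eq.subset
  refine closure_minimal ((support_convolution_subset (.lsmul ℝ ℝ)).trans
    ((add_subset_add hsupport φ.support_normed_eq.subset).trans ?_)) isClosed_closedBall
  rw [ball_add_ball χ.rOut_pos φ.rOut_pos, add_zero]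
  exact ball_subset_closedBall

lemma IsWeaklyScreenedHarmonicOn.sub_convolution_normed_eq_zero
    (hw : IsWeaklyScreenedHarmonicOn k w U) (hk : 0 ≤ k) (hwc : Continuous w)
    (χ φ : ContDiffBump (0 : E3)) {x : E3} (hx : closedBall x (χ.rOut + φ.rOut) ⊆ U) :
    ((w - w ⋆ parametrixError χ k) ⋆ φ.normed volume) x = 0 := by
  set η := parametrixError χ k
  set ρ : E3 → ℝ := φ.normed volume
  have hρ {n : ℕ∞} : ContDiff ℝ n ρ := φ.contDiff_normed
  have hρ0 : Continuous ρ := φ.continuous_normed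
  have hρc : HasCompactSupport ρ := φ.hasCompactSupport_normed
  have hη : Continuous η := (contDiff_parametrixError (n := 0) χ).continuous
  have hηc : HasCompactSupport η := hasCompactSupport_parametrixError χ
  have hwη : Continuous (w ⋆ η) :=
    hηc.continuous_convolution_right (.lsmul ℝ ℝ) hwc.locallyIntegrable hη
  have hηρ : Continuous (η ⋆ ρ) :=
    hρc.continuous_convolution_right (.lsmul ℝ ℝ) hη.locallyIntegrable hρ0
  have hηρc : HasCompactSupport (η ⋆ ρ) := hηc.convolution (.lsmul ℝ ℝ) hρc
  have hψ {n : ℕ∞} : ContDiff ℝ n (parametrix χ k ⋆ ρ) :=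
    hρc.contDiff_convolution_right (.lsmul ℝ ℝ) (locallyIntegrable_parametrix χ hk) hρ
  have hψs := tsupport_parametrix_convolution_subset (k := k) χ φ
  have htest : (w ⋆ (ρ - η ⋆ ρ)) x = 0 := by
    have hsupp := tsupport_comp_const_sub_subset hψs x
    have hzero := hw (fun z => (parametrix χ k ⋆ ρ) (x - z))
      (hψ.comp (contDiff_const.sub contDiff_id))
      (HasCompactSupport.of_support_subset_isCompact (isCompact_closedBall x _)
        (subset_closure.trans hsupp)) (hsupp.trans hx)
    simp only [screenedLaplacian_comp_const_sub (hψ (n := 2)),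
      screenedLaplacian_parametrix_convolution χ hk (hρ (n := 2)) hρc] at hzero
    exact hzero
  have hleft : (w - w ⋆ η) ⋆ ρ + (w ⋆ η) ⋆ ρ = w ⋆ ρ := by
    rw [← ConvolutionExists.add_distrib, sub_add_cancel]
    · exact hρc.convolutionExists_right _ (hwc.sub hwη).locallyIntegrable hρ0
    · exact hρc.convolutionExists_right _ hwη.locallyIntegrable hρ0
  have hright : w ⋆ (ρ - η ⋆ ρ) + w ⋆ (η ⋆ ρ) = w ⋆ ρ := by
    rw [← ConvolutionExists.distrib_add, sub_add_cancel]
    · exact (hρc.sub hηρc).convolutionExists_right _ hwc.locallyIntegrable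
        (hρ0.sub hηρ)
    · exact hηρc.convolutionExists_right _ hwc.locallyIntegrable hηρ
  rw [convolution_assoc_of_continuous hwc.locallyIntegrable hη hηc hρ0 hρc,
    ← hright] at hleft
  rw [add_right_cancel hleft, htest]

lemma IsWeaklyScreenedHarmonicOn.eq_convolution_parametrixError
    (hw : IsWeaklyScreenedHarmonicOn k w U) (hk : 0 ≤ k) (hwc : Continuous w)
    (χ : ContDiffBump (0 : E3)) {x : E3} (hx : ball x (2 * χ.rOut) ⊆ U) :
    w x = (w ⋆ parametrixError χ k) x := by
  have hd : Continuous (w - w ⋆ parametrixError χ k) :=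
    hwc.sub ((hasCompactSupport_parametrixError χ).continuous_convolution_right (.lsmul ℝ ℝ)
      hwc.locallyIntegrable (contDiff_parametrixError (n := 0) χ).continuous)
  refine sub_eq_zero.1 (eq_of_forall_dist_le fun ε hε => ?_)
  obtain ⟨δ, hδ, hdδ⟩ := Metric.continuous_iff.1 hd x ε hε
  set r := min δ χ.rOut / 2
  have hrpos : 0 < r := half_pos (lt_min hδ χ.rOut_pos)
  have hrδ : r < δ := (half_lt_self (lt_min hδ χ.rOut_pos)).trans_le (min_le_left ..)
  have hrχ : r < χ.rOut := (half_lt_self (lt_min hδ χ.rOut_pos)).trans_le (min_le_right ..)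
  set φ : ContDiffBump (0 : E3) := ⟨r / 2, r, half_pos hrpos, half_lt_self hrpos⟩
  have hmoll := φ.dist_normed_convolution_le (μ := volume) (x₀ := x) hd.aestronglyMeasurable
    fun z hz => (hdδ z ((mem_ball.1 hz).trans hrδ)).le
  rw [convolution_swap, hw.sub_convolution_normed_eq_zero hk hwc χ φ
    ((closedBall_subset_ball (by linarith [hrχ])).trans hx)] at hmoll
  rwa [dist_comm]

lemma IsWeaklyScreenedHarmonicOn.eventuallyEq_convolution_parametrixError
    (hw : IsWeaklyScreenedHarmonicOn k w U) (hk : 0 ≤ k) (hwc : Continuous w)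
    (χ : ContDiffBump (0 : E3)) {x : E3} (hx : ball x (3 * χ.rOut) ⊆ U) :
    w =ᶠ[𝓝 x] w ⋆ parametrixError χ k := by
  filter_upwards [ball_mem_nhds x χ.rOut_pos] with z hz
  exact hw.eq_convolution_parametrixError hk hwc χ
    ((ball_subset_ball' (by linarith [mem_ball.1 hz])).trans hx)

/-- Weyl's lemma: near `x`, `w` coincides with its convolution with a smooth function. -/
theorem IsWeaklyScreenedHarmonicOn.contDiffAt_and_screenedLaplacian_eq_zero
    (hw : IsWeaklyScreenedHarmonicOn k w U) (hk : 0 ≤ k) (hwc : Continuous w) {x : E3}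
    (hx : U ∈ 𝓝 x) : ContDiffAt ℝ ∞ w x ∧ screenedLaplacian k w x = 0 := by
  obtain ⟨δ, hδ, hδU⟩ := Metric.mem_nhds_iff.1 hx
  let χ : ContDiffBump (0 : E3) := ⟨δ / 6, δ / 3, by positivity, by linarith⟩
  have hη {n : ℕ∞} : ContDiff ℝ n (parametrixError χ k) := contDiff_parametrixError χ
  have hηc := hasCompactSupport_parametrixError (k := k) χ
  have heq := hw.eventuallyEq_convolution_parametrixError hk hwc χ
    ((ball_subset_ball (by simp [χ]; linarith)).trans hδU)
  refine ⟨(hηc.contDiff_convolution_right (.lsmul ℝ ℝ) hwc.locallyIntegrable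
    hη).contDiffAt.congr_of_eventuallyEq heq, ?_⟩
  rw [screenedLaplacian_congr heq, screenedLaplacian_convolution hwc.locallyIntegrable
    (hη (n := 2)) hηc]
  simp only [convolution_lsmul, smul_eq_mul, ← screenedLaplacian_comp_const_sub (hη (n := 2))]
  exact hw _ (hη.comp (contDiff_const.sub contDiff_id))
    (hηc.comp_homeomorph (Homeomorph.subLeft x))
    ((tsupport_comp_const_sub_subset (tsupport_parametrixError_subset χ) x).trans
      ((closedBall_subset_ball (by simp [χ]; linarith)).trans hδU))

end WeylLemma

section Potential

variable {k : ℝ} {H H' φ : E3 → ℝ} {U : Set E3}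

/-- The potential of the density `H`: the solution of `Δ u - k² u = H` on the whole space given by
the fundamental solution `yukawa k`. -/
def potential (k : ℝ) (H : E3 → ℝ) : E3 → ℝ := H ⋆ yukawa k

lemma exists_lipschitzWith_potential (hk : 0 ≤ k) (hH : BoundedIntegrable H) :
    ∃ C, LipschitzWith C (potential k H) :=
  (weaklySingular_yukawa hk).exists_lipschitzWith_convolution (by simp)
    (fun _ _ => abs_yukawa_sub_le hk) hH

lemma continuous_potential (hk : 0 ≤ k) (hH : BoundedIntegrable H) : Continuous (potential k H) :=
  (exists_lipschitzWith_potential hk hH).choose_spec.continuous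

lemma exists_abs_potential_le (hk : 0 ≤ k) (hH : BoundedIntegrable H) :
    ∃ C, ∀ x, |potential k H x| ≤ C := by
  obtain ⟨C, hC⟩ := (weaklySingular_yukawa hk).exists_integral_abs_mul_le hH
  exact ⟨C, fun x => (abs_integral_le_integral_abs).trans (hC x)⟩

lemma potential_add (hk : 0 ≤ k) (hH : BoundedIntegrable H) (hH' : BoundedIntegrable H') :
    potential k (H + H') = potential k H + potential k H' :=
  ConvolutionExists.add_distrib (fun x => (weaklySingular_yukawa hk).integrable_mul hH x)
    fun x => (weaklySingular_yukawa hk).integrable_mul hH' x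

lemma integral_potential_mul_screenedLaplacian (hk : 0 ≤ k) (hH : BoundedIntegrable H)
    (hφ : ContDiff ℝ 2 φ) (hφc : HasCompactSupport φ) :
    ∫ z, potential k H z * screenedLaplacian k φ z = ∫ z, H z * φ z := by
  have hLφ : BoundedIntegrable (screenedLaplacian k φ) :=
    .of_hasCompactSupport (contDiff_screenedLaplacian (m := 0) hφ (by simp) k).continuous
      (hasCompactSupport_screenedLaplacian hφc k)
  rw [potential, (weaklySingular_yukawa hk).integral_convolution_mul_eq yukawa_neg hH hLφ,
    convolution_swap, yukawa_convolution_screenedLaplacian hk hφ hφc]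

lemma isWeaklyScreenedHarmonicOn_potential (hk : 0 ≤ k) (hH : BoundedIntegrable H)
    (hzero : EqOn H 0 U) : IsWeaklyScreenedHarmonicOn k (potential k H) U := by
  intro φ hφ hφc hφU
  rw [integral_potential_mul_screenedLaplacian hk hH (contDiff_infty.1 hφ 2) hφc]
  refine integral_eq_zero_of_ae (Eventually.of_forall fun z => ?_)
  by_cases hz : z ∈ U
  · simp [hzero hz]
  · simp [image_eq_zero_of_notMem_tsupport fun h => hz (hφU h)]

lemma contDiffAt_potential_of_eqOn_zero (hk : 0 ≤ k) (hH : BoundedIntegrable H)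
    {x : E3} (hU : U ∈ 𝓝 x) (hzero : EqOn H 0 U) :
    ContDiffAt ℝ ∞ (potential k H) x ∧ screenedLaplacian k (potential k H) x = 0 :=
  (isWeaklyScreenedHarmonicOn_potential hk hH hzero
    ).contDiffAt_and_screenedLaplacian_eq_zero hk (continuous_potential hk hH) hU

lemma contDiff_potential (hk : 0 ≤ k) {n : ℕ∞} (hφ : ContDiff ℝ n φ) (hφc : HasCompactSupport φ) :
    ContDiff ℝ n (potential k φ) := by
  rw [potential, convolution_swap]
  exact hφc.contDiff_convolution_right _ (locallyIntegrable_yukawa hk) hφ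

lemma screenedLaplacian_potential (hk : 0 ≤ k) (hφ : ContDiff ℝ 2 φ)
    (hφc : HasCompactSupport φ) : screenedLaplacian k (potential k φ) = φ := by
  rw [potential, convolution_swap, screenedLaplacian_convolution (locallyIntegrable_yukawa hk)
    hφ hφc, yukawa_convolution_screenedLaplacian hk hφ hφc]

lemma screenedLaplacian_add {f g : E3 → ℝ} {x : E3} (hf : ContDiffAt ℝ 2 f x)
    (hg : ContDiffAt ℝ 2 g x) :
    screenedLaplacian k (f + g) x = screenedLaplacian k f x + screenedLaplacian k g x := by
  simp only [screenedLaplacian, hf.laplacian_add hg, Pi.add_apply]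
  ring

/-- Only the part of the density away from the point needs Weyl's lemma; the rest is a convolution
with a smooth function of compact support. -/
theorem contDiffAt_potential (hk : 0 ≤ k) (hH : BoundedIntegrable H) (hU : IsOpen U)
    (hHU : ContDiffOn ℝ ∞ H U) {x : E3} (hx : x ∈ U) :
    ContDiffAt ℝ ∞ (potential k H) x ∧ screenedLaplacian k (potential k H) x = H x := by
  obtain ⟨δ, hδ, hδU⟩ := Metric.isOpen_iff.1 hU x hx
  let χ : ContDiffBump x := ⟨δ / 4, δ / 2, by positivity, by linarith⟩
  have hχU : tsupport χ ⊆ U := by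
    rw [χ.tsupport_eq]
    exact (closedBall_subset_ball (half_lt_self hδ)).trans hδU
  have hnear {n : ℕ∞} : ContDiff ℝ n (⇑χ * H) := by
    refine contDiff_iff_contDiffAt.2 fun z => ?_
    by_cases hz : z ∈ tsupport χ
    · exact χ.contDiffAt.mul (((hHU z (hχU hz)).contDiffAt (hU.mem_nhds (hχU hz))).of_le
        (mod_cast le_top))
    · exact contDiffAt_const (c := (0 : ℝ)).congr_of_eventuallyEq
        ((notMem_tsupport_iff_eventuallyEq.1 hz).mono fun w hw => by simp [hw])
  have hnearc : HasCompactSupport (⇑χ * H) := χ.hasCompactSupport.mul_right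
  have hnearB : BoundedIntegrable (⇑χ * H) :=
    .of_hasCompactSupport (hnear (n := 0)).continuous hnearc
  have hfarB : BoundedIntegrable (H - ⇑χ * H) := hH.sub hnearB
  have hfarzero : EqOn (H - ⇑χ * H) 0 (ball x (δ / 4)) := fun z hz => by
    simp [χ.one_of_mem_closedBall (ball_subset_closedBall hz)]
  obtain ⟨hfar, hLfar⟩ := contDiffAt_potential_of_eqOn_zero hk hfarB
    (ball_mem_nhds x (by positivity)) hfarzero
  have hsplit : potential k H = potential k (⇑χ * H) + potential k (H - ⇑χ * H) := by
    rw [← potential_add hk hnearB hfarB, add_sub_cancel]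
  rw [hsplit]
  refine ⟨(contDiff_potential hk hnear hnearc).contDiffAt.add hfar, ?_⟩
  rw [screenedLaplacian_add (contDiff_potential hk (hnear (n := 2)) hnearc).contDiffAt
    (contDiffAt_infty.1 hfar 2), screenedLaplacian_potential hk (hnear (n := 2)) hnearc, hLfar]
  simp [χ.eventuallyEq_one.self_of_nhds]

end Potential

/-! ### Smoothness up to the boundary of a convex open set -/

section ContDiffUpTo

variable {E : Type*} [NormedAddCommGroup E] {Ω : Set E} {w w' : E → ℝ}

section NormedSpace

variable [NormedSpace ℝ E] {n : ℕ}

lemma uniqueDiffOn_closure (hΩ : IsOpen Ω) (hconv : Convex ℝ Ω) :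
    UniqueDiffOn ℝ (closure Ω) := by
  rcases Ω.eq_empty_or_nonempty with rfl | hne
  · simp only [closure_empty, uniqueDiffOn_empty]
  · exact uniqueDiffOn_convex hconv.closure
      (hne.mono (hΩ.subset_interior_iff.2 subset_closure))

/-- `w` is of class `C^n` on `Ω` up to the boundary: its restriction to `Ω` extends to a function
of class `C^n` on the closure. The values of `w` outside `Ω` are irrelevant, so that derivatives
of `w`, which carry information in the interior only, qualify. -/
def ContDiffUpTo (n : ℕ) (Ω : Set E) (w : E → ℝ) : Prop :=
  ∃ Q, ContDiffOn ℝ n Q (closure Ω) ∧ EqOn w Q Ω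

lemma contDiffUpTo_of_contDiffOn (hw : ContDiffOn ℝ n w (closure Ω)) : ContDiffUpTo n Ω w :=
  ⟨w, hw, eqOn_refl w Ω⟩

lemma ContDiffUpTo.congr (hw : ContDiffUpTo n Ω w) (h : EqOn w' w Ω) : ContDiffUpTo n Ω w' :=
  let ⟨Q, hQ, hwQ⟩ := hw
  ⟨Q, hQ, h.trans hwQ⟩

lemma ContDiffUpTo.add (hw : ContDiffUpTo n Ω w) (hw' : ContDiffUpTo n Ω w') :
    ContDiffUpTo n Ω (fun x => w x + w' x) :=
  let ⟨Q, hQ, hwQ⟩ := hw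
  let ⟨Q', hQ', hwQ'⟩ := hw'
  ⟨Q + Q', hQ.add hQ', fun _ hx => congrArg₂ (· + ·) (hwQ hx) (hwQ' hx)⟩

lemma ContDiffUpTo.const_mul (hw : ContDiffUpTo n Ω w) (c : ℝ) :
    ContDiffUpTo n Ω (fun x => c * w x) :=
  let ⟨Q, hQ, hwQ⟩ := hw
  ⟨fun x => c * Q x, contDiffOn_const.mul hQ, fun _ hx => congrArg (c * ·) (hwQ hx)⟩

lemma ContDiffUpTo.contDiffOn (hw : ContDiffUpTo n Ω w) (hcont : ContinuousOn w (closure Ω)) :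
    ContDiffOn ℝ n w (closure Ω) :=
  let ⟨_, hQ, hwQ⟩ := hw
  hQ.congr (hwQ.of_subset_closure hcont hQ.continuousOn subset_closure subset_rfl)

end NormedSpace

variable [InnerProductSpace ℝ E] {ι : Type*} [Fintype ι]

lemma fderiv_eq_sum_dirDeriv (b : OrthonormalBasis ι ℝ E) (w : E → ℝ) (x : E) :
    fderiv ℝ w x = ∑ i, dirDeriv (b i) w x • innerSL ℝ (b i) := by
  ext v
  conv_lhs => rw [← b.sum_repr v, map_sum]
  simp [dirDeriv, b.repr_apply_apply, mul_comm]

lemma contDiffUpTo_zero_of_abs_dirDeriv_le (b : OrthonormalBasis ι ℝ E) (hconv : Convex ℝ Ω)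
    (hd : ∀ x ∈ Ω, DifferentiableAt ℝ w x) {C : ι → ℝ}
    (hC : ∀ i, ∀ x ∈ Ω, |dirDeriv (b i) w x| ≤ C i) : ContDiffUpTo 0 Ω w := by
  have hbound : ∀ x ∈ Ω, ‖fderiv ℝ w x‖₊ ≤ (∑ i, C i).toNNReal := fun x hx => by
    refine NNReal.coe_le_coe.1 (le_trans ?_ (Real.le_coe_toNNReal _))
    rw [coe_nnnorm, fderiv_eq_sum_dirDeriv b]
    refine (norm_sum_le _ _).trans (Finset.sum_le_sum fun i _ => ?_)
    rw [norm_smul, innerSL_apply_norm, b.norm_eq_one, mul_one]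
    exact hC i x hx
  obtain ⟨Q, hQ, hwQ⟩ := (hconv.lipschitzOnWith_of_nnnorm_fderiv_le hd hbound).extend_real
  exact ⟨Q, contDiffOn_zero.2 hQ.continuous.continuousOn, hwQ⟩

lemma contDiffUpTo_succ_of_dirDeriv (b : OrthonormalBasis ι ℝ E) (hΩ : IsOpen Ω)
    (hconv : Convex ℝ Ω) {n : ℕ} (hw : ContDiffUpTo 0 Ω w) (hd : ∀ x ∈ Ω, DifferentiableAt ℝ w x)
    (hpartial : ∀ i, ContDiffUpTo n Ω (dirDeriv (b i) w)) : ContDiffUpTo (n + 1) Ω w := by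
  obtain ⟨Q, hQ, hwQ⟩ := hw
  choose P hP hwP using hpartial
  refine ⟨Q, ?_, hwQ⟩
  have hQc : ContinuousOn Q (closure Ω) := hQ.continuousOn
  have hderiv : ∀ x ∈ Ω, HasFDerivAt Q (∑ i, P i x • innerSL ℝ (b i)) x := fun x hx => by
    have hev : Q =ᶠ[𝓝 x] w := (hwQ.eventuallyEq_of_mem (hΩ.mem_nhds hx)).symm
    refine HasFDerivAt.congr_of_eventuallyEq ?_ hev
    simpa only [fderiv_eq_sum_dirDeriv b, hwP _ hx] using (hd x hx).hasFDerivAt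
  have hPs : ContDiffOn ℝ n (fun x => ∑ i, P i x • innerSL ℝ (b i)) (closure Ω) :=
    ContDiffOn.sum fun i _ => (hP i).smul contDiffOn_const
  rw [Nat.cast_succ, contDiffOn_succ_iff_hasFDerivWithinAt_of_uniqueDiffOn
    (uniqueDiffOn_closure hΩ hconv)]
  refine ⟨by simp, _, hPs, fun x hx => ?_⟩
  refine hasFDerivWithinAt_closure_of_tendsto_fderiv
    (fun z hz => (hderiv z hz).differentiableAt.differentiableWithinAt) hconv hΩ
    (fun z hz => (hQc z hz).mono subset_closure) ?_
  refine ((hPs.continuousOn x hx).mono subset_closure).tendsto.congr' ?_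
  filter_upwards [self_mem_nhdsWithin] with z hz using (hderiv z hz).fderiv.symm

end ContDiffUpTo

/-! ### The half-space and odd reflection -/

section Reflection

variable {k : ℝ} {g : E3 → ℝ} {x v : E3}

/-- The standard orthonormal basis of `E3`; `axes 2` is the inner normal of the boundary. -/
abbrev axes : OrthonormalBasis (Fin 3) ℝ E3 := EuclideanSpace.basisFun (Fin 3) ℝ

lemma isOpen_openHalf : IsOpen openHalf := isOpen_lt continuous_const (by fun_prop)

lemma openHalf_subset_closedHalf : openHalf ⊆ closedHalf :=
  ofPred_subset_ofPred.2 fun _ => le_of_lt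

lemma closedHalf_mem_nhds (hx : x ∈ openHalf) : closedHalf ∈ 𝓝 x :=
  mem_of_superset (isOpen_openHalf.mem_nhds hx) openHalf_subset_closedHalf

lemma convex_openHalf : Convex ℝ openHalf :=
  convex_halfSpace_gt (EuclideanSpace.proj (𝕜 := ℝ) (2 : Fin 3)).isLinear 0

lemma closure_openHalf : closure openHalf = closedHalf :=
  closure_open_halfSpace 2 0 2

lemma isClosed_closedHalf : IsClosed closedHalf := closure_openHalf ▸ isClosed_closure

lemma uniqueDiffOn_closedHalf : UniqueDiffOn ℝ closedHalf :=
  closure_openHalf ▸ uniqueDiffOn_closure isOpen_openHalf convex_openHalf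

/-- The reflection in the boundary plane. -/
def reflect : E3 ≃ₗᵢ[ℝ] E3 := (ℝ ∙ axes 2)ᗮ.reflection

lemma reflect_apply (x : E3) : reflect x = x - (2 * x 2) • axes 2 := by
  rw [reflect, Submodule.reflection_orthogonal_apply, Submodule.reflection_singleton_apply]
  simp only [EuclideanSpace.basisFun_apply, EuclideanSpace.inner_single_left, map_one, one_mul,
    PiLp.norm_single, norm_one, two_smul]
  module

lemma reflect_reflect (x : E3) : reflect (reflect x) = x := Submodule.reflection_reflection _ x

lemma reflect_apply_two (x : E3) : reflect x 2 = -x 2 := by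
  simp [reflect_apply]
  ring

lemma reflect_of_apply_two_eq_zero (hv : v 2 = 0) : reflect v = v := by simp [reflect_apply, hv]

lemma reflect_notMem_openHalf (hx : x ∈ openHalf) : reflect x ∉ openHalf := by
  have hx' : 0 < x 2 := hx
  simp [openHalf, reflect_apply_two, hx'.le]

/-- The extension of the restriction of `g` to the open half-space which is odd under `reflect`; it
vanishes on the boundary plane. -/
def oddExt (g : E3 → ℝ) (x : E3) : ℝ := openHalf.indicator g x - openHalf.indicator g (reflect x)

lemma oddExt_reflect (g : E3 → ℝ) (x : E3) : oddExt g (reflect x) = -oddExt g x := by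
  simp [oddExt, reflect_reflect]

lemma oddExt_eqOn (g : E3 → ℝ) : EqOn (oddExt g) g openHalf := fun x hx => by
  rw [oddExt, indicator_of_mem hx, indicator_of_notMem (reflect_notMem_openHalf hx), sub_zero]

lemma abs_oddExt_le {b : ℝ} (hb : 0 ≤ b) (h : ∀ z ∈ closedHalf, ‖z‖ = ‖x‖ → |g z| ≤ b) :
    |oddExt g x| ≤ b := by
  by_cases hx : x ∈ openHalf
  · rw [oddExt_eqOn g hx]
    exact h x (openHalf_subset_closedHalf hx) rfl
  · rw [oddExt, indicator_of_notMem hx, zero_sub, abs_neg]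
    by_cases hx' : reflect x ∈ openHalf
    · rw [indicator_of_mem hx']
      exact h _ (openHalf_subset_closedHalf hx') (reflect.norm_map x)
    · rwa [indicator_of_notMem hx', abs_zero]

lemma aestronglyMeasurable_oddExt (hg : ContinuousOn g closedHalf) :
    AEStronglyMeasurable (oddExt g) := by
  have hind : AEStronglyMeasurable (openHalf.indicator g) :=
    (aestronglyMeasurable_indicator_iff isOpen_openHalf.measurableSet).2
      ((hg.mono openHalf_subset_closedHalf).aestronglyMeasurable isOpen_openHalf.measurableSet)
  exact hind.sub (hind.comp_measurePreserving reflect.measurePreserving)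

lemma contDiffOn_oddExt (hg : ContDiffOn ℝ ∞ g closedHalf) :
    ContDiffOn ℝ ∞ (oddExt g) openHalf :=
  (hg.mono openHalf_subset_closedHalf).congr (oddExt_eqOn g)

lemma potential_oddExt_reflect (k : ℝ) (g : E3 → ℝ) (x : E3) :
    potential k (oddExt g) (reflect x) = -potential k (oddExt g) x := by
  rw [potential, convolution_lsmul, convolution_lsmul, ← integral_neg,
    ← reflect.measurePreserving.integral_comp reflect.toHomeomorph.measurableEmbedding]
  congr 1 with z
  rw [oddExt_reflect, ← map_sub, yukawa, yukawa, reflect.norm_map, neg_smul]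

lemma potential_oddExt_eq_zero (k : ℝ) (g : E3 → ℝ) (hx : x 2 = 0) :
    potential k (oddExt g) x = 0 := by
  have hodd := potential_oddExt_reflect k g x
  rw [reflect_of_apply_two_eq_zero hx] at hodd
  linarith

end Reflection

section Densities

variable {g : E3 → ℝ} {p : ℝ}

lemma exists_abs_le_mul_one_add_norm_rpow (hp : 0 ≤ p) (hg : ContinuousOn g closedHalf)
    (hdecay : DecaysAtInfinity g p) :
    ∃ C, 0 ≤ C ∧ ∀ x ∈ closedHalf, |g x| ≤ C * (1 + ‖x‖) ^ (-p) := by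
  obtain ⟨C, R, hR, hC⟩ := hdecay
  obtain ⟨M, hM⟩ := ((isCompact_closedBall (0 : E3) (max R 1)).inter_right
    isClosed_closedHalf).exists_bound_of_continuousOn
      (f := fun x => g x * (1 + ‖x‖) ^ p) ((hg.mono inter_subset_right).mul
        (Continuous.rpow_const (by fun_prop) fun _ => .inr hp).continuousOn)
  refine ⟨max |M| (C * 2 ^ p), (abs_nonneg M).trans (le_max_left _ _), fun x hx => ?_⟩
  have hx1 : 0 < (1 + ‖x‖) ^ p := by positivity
  rw [Real.rpow_neg (by positivity), ← div_eq_mul_inv, le_div_iff₀ hx1]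
  by_cases hxR : ‖x‖ ≤ max R 1
  · calc |g x| * (1 + ‖x‖) ^ p = ‖g x * (1 + ‖x‖) ^ p‖ := by
          rw [norm_mul, Real.norm_eq_abs, Real.norm_of_nonneg hx1.le]
      _ ≤ |M| := (hM x ⟨by simpa using hxR, hx⟩).trans (le_abs_self M)
      _ ≤ _ := le_max_left _ _
  · obtain ⟨hxR, hx1⟩ := max_lt_iff.1 (not_le.1 hxR)
    have hx0 : 0 < ‖x‖ := by linarith
    have hgx : |g x| ≤ C * ‖x‖ ^ (-p) := hC x hx hxR.le
    calc |g x| * (1 + ‖x‖) ^ p ≤ C * ‖x‖ ^ (-p) * (2 * ‖x‖) ^ p := by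
          gcongr
          · exact (abs_nonneg _).trans hgx
          · linarith
      _ = C * 2 ^ p := by
          rw [Real.mul_rpow zero_le_two hx0.le, Real.rpow_neg hx0.le]
          field_simp
      _ ≤ _ := le_max_right _ _

lemma exists_abs_oddExt_le (hp : 0 ≤ p) (hg : ContinuousOn g closedHalf)
    (hdecay : DecaysAtInfinity g p) : ∃ C, ∀ x, |oddExt g x| ≤ C * (1 + ‖x‖) ^ (-p) := by
  obtain ⟨C, hC, hgC⟩ := exists_abs_le_mul_one_add_norm_rpow hp hg hdecay
  exact ⟨C, fun x => abs_oddExt_le (by positivity) fun z hz hzx => hzx ▸ hgC z hz⟩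

lemma boundedIntegrable_oddExt (hp : 3 < p) (hg : ContinuousOn g closedHalf)
    (hdecay : DecaysAtInfinity g p) : BoundedIntegrable (oddExt g) := by
  obtain ⟨C, hgC⟩ := exists_abs_oddExt_le (by linarith) hg hdecay
  exact boundedIntegrable_of_abs_le_rpow (by simpa using hp) (aestronglyMeasurable_oddExt hg) hgC

lemma contDiffAt_potential_oddExt {k : ℝ} {x : E3} (hk : 0 ≤ k) (hgi : BoundedIntegrable (oddExt g))
    (hg : ContDiffOn ℝ ∞ g closedHalf) (hx : x ∈ openHalf) :
    ContDiffAt ℝ ∞ (potential k (oddExt g)) x ∧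
      screenedLaplacian k (potential k (oddExt g)) x = g x :=
  oddExt_eqOn g hx ▸ contDiffAt_potential hk hgi isOpen_openHalf (contDiffOn_oddExt hg) hx

end Densities

/-! ### Boundary regularity -/

section BoundaryRegularity

variable {g : E3 → ℝ} {k : ℝ} {v x : E3}

/-- Functions which are smooth on the closed half-space and vanish there outside a bounded set.
This class of densities is preserved by all derivatives up to the boundary. -/
structure IsTestOnClosedHalf (g : E3 → ℝ) : Prop where
  contDiffOn : ContDiffOn ℝ ∞ g closedHalf
  exists_eq_zero : ∃ R, ∀ x ∈ closedHalf, R ≤ ‖x‖ → g x = 0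

/-- The derivative in the direction `v` up to the boundary of the half-space. -/
def halfDeriv (v : E3) (g : E3 → ℝ) (x : E3) : ℝ := fderivWithin ℝ g closedHalf x v

lemma IsTestOnClosedHalf.halfDeriv (hg : IsTestOnClosedHalf g) (v : E3) :
    IsTestOnClosedHalf (halfDeriv v g) := by
  refine ⟨(hg.contDiffOn.fderivWithin uniqueDiffOn_closedHalf (m := ∞) (by simp)).clm_apply
    contDiffOn_const, ?_⟩
  obtain ⟨R, hR⟩ := hg.exists_eq_zero
  refine ⟨R + 1, fun x hx hxR => ?_⟩
  have hzero : g =ᶠ[𝓝[closedHalf] x] fun _ => 0 := by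
    have hfar : ∀ᶠ z in 𝓝[closedHalf] x, R < ‖z‖ :=
      nhdsWithin_le_nhds (continuous_norm.continuousAt.eventually (lt_mem_nhds (by linarith)))
    filter_upwards [hfar, self_mem_nhdsWithin] with z hz hzmem using hR z hzmem hz.le
  rw [HalfSpace.halfDeriv, hzero.fderivWithin_eq (hR x hx (by linarith)), fderivWithin_const_apply,
    zero_apply]

lemma IsTestOnClosedHalf.boundedIntegrable_oddExt (hg : IsTestOnClosedHalf g) :
    BoundedIntegrable (oddExt g) := by
  obtain ⟨R, hR⟩ := hg.exists_eq_zero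
  refine HalfSpace.boundedIntegrable_oddExt (p := 4) (by norm_num) hg.contDiffOn.continuousOn
    ⟨0, max R 1, by positivity, fun x hx hxR => ?_⟩
  rw [hR x hx ((le_max_left _ _).trans hxR), abs_zero, zero_mul]

lemma IsTestOnClosedHalf.exists_oddExt_eq_zero (hg : IsTestOnClosedHalf g) :
    ∃ R, ∀ x, R < ‖x‖ → oddExt g x = 0 := by
  obtain ⟨R, hR⟩ := hg.exists_eq_zero
  refine ⟨R, fun x hx => abs_nonpos_iff.1 (abs_oddExt_le le_rfl fun z hz hzx => ?_)⟩
  rw [hR z hz (hzx ▸ hx.le), abs_zero]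

lemma hasLineDerivAt_indicator_openHalf (hg : DifferentiableOn ℝ g closedHalf) (hv : v 2 = 0)
    (x : E3) :
    HasLineDerivAt ℝ (openHalf.indicator g) (openHalf.indicator (halfDeriv v g) x) x v := by
  have hmem : ∀ t : ℝ, x + t • v ∈ openHalf ↔ x ∈ openHalf := fun t => by simp [openHalf, hv]
  by_cases hx : x ∈ openHalf
  · have hd : HasFDerivAt g (fderivWithin ℝ g closedHalf x) x :=
      (hg x (openHalf_subset_closedHalf hx)).hasFDerivWithinAt.hasFDerivAt (closedHalf_mem_nhds hx)
    rw [indicator_of_mem hx]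
    refine (hd.hasLineDerivAt v).congr_of_eventuallyEq ?_
    filter_upwards [isOpen_openHalf.mem_nhds hx] with z hz using indicator_of_mem hz g
  · rw [indicator_of_notMem hx]
    simpa only [HasLineDerivAt, indicator_of_notMem (mt (hmem _).1 hx)]
      using hasDerivAt_const (0 : ℝ) (0 : ℝ)

lemma hasLineDerivAt_oddExt (hg : DifferentiableOn ℝ g closedHalf) (hv : v 2 = 0) (x : E3) :
    HasLineDerivAt ℝ (oddExt g) (oddExt (halfDeriv v g) x) x v := by
  have hrefl := hasLineDerivAt_indicator_openHalf hg hv (reflect x)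
  have hsub := HasDerivAt.sub (hasLineDerivAt_indicator_openHalf hg hv x) hrefl
  refine hsub.congr_of_eventuallyEq (Eventually.of_forall fun t => ?_)
  simp [oddExt, reflect_of_apply_two_eq_zero hv]

lemma hasLineDerivAt_potential_oddExt (hk : 0 ≤ k) (hg : IsTestOnClosedHalf g) (hv : v 2 = 0)
    (x : E3) :
    HasLineDerivAt ℝ (potential k (oddExt g)) (potential k (oddExt (halfDeriv v g)) x) x v := by
  obtain ⟨R, hR⟩ := (hg.halfDeriv v).exists_oddExt_eq_zero
  exact (weaklySingular_yukawa hk).hasLineDerivAt_convolution hg.boundedIntegrable_oddExt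
    (hg.halfDeriv v).boundedIntegrable_oddExt hR
    (hasLineDerivAt_oddExt (hg.contDiffOn.differentiableOn (by simp)) hv) x

lemma dirDeriv_potential_oddExt (hk : 0 ≤ k) (hg : IsTestOnClosedHalf g) (hv : v 2 = 0) :
    EqOn (dirDeriv v (potential k (oddExt g))) (potential k (oddExt (halfDeriv v g))) openHalf :=
  fun x hx => HasLineDerivAt.unique
    (((contDiffAt_potential_oddExt hk hg.boundedIntegrable_oddExt hg.contDiffOn hx).1
      ).differentiableAt (by simp) |>.hasFDerivAt.hasLineDerivAt v)
    (hasLineDerivAt_potential_oddExt hk hg hv x)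

lemma dirDeriv_dirDeriv_potential_oddExt (hk : 0 ≤ k) (hg : IsTestOnClosedHalf g) (hv : v 2 = 0)
    (w : E3) :
    EqOn (dirDeriv v (dirDeriv w (potential k (oddExt g))))
      (dirDeriv w (potential k (oddExt (halfDeriv v g)))) openHalf := fun x hx => by
  have hsmooth := (contDiffAt_potential_oddExt hk hg.boundedIntegrable_oddExt hg.contDiffOn hx).1
  rw [dirDeriv_comm (contDiffAt_infty.1 hsmooth 2)]
  exact (dirDeriv_congr ((dirDeriv_potential_oddExt hk hg hv).eventuallyEq_of_mem
    (isOpen_openHalf.mem_nhds hx)) w).eq_of_nhds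

lemma axes_apply_two {i : Fin 3} (hi : i ≠ 2) : (axes i : E3) 2 = 0 := by
  simp [EuclideanSpace.basisFun_apply, hi.symm]

lemma dirDeriv_normal_normal_potential_oddExt (hk : 0 ≤ k) (hg : IsTestOnClosedHalf g) :
    EqOn (dirDeriv (axes 2) (dirDeriv (axes 2) (potential k (oddExt g))))
      (fun x => g x + k ^ 2 * potential k (oddExt g) x +
        (-1) * potential k (oddExt (halfDeriv (axes 0) (halfDeriv (axes 0) g))) x +
        (-1) * potential k (oddExt (halfDeriv (axes 1) (halfDeriv (axes 1) g))) x)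
      openHalf := fun x hx => by
  obtain ⟨hsmooth, heq⟩ :=
    contDiffAt_potential_oddExt hk hg.boundedIntegrable_oddExt hg.contDiffOn hx
  have htangential : ∀ i : Fin 3, i ≠ 2 →
      dirDeriv (axes i) (dirDeriv (axes i) (potential k (oddExt g))) x =
        potential k (oddExt (halfDeriv (axes i) (halfDeriv (axes i) g))) x := fun i hi =>
    (dirDeriv_dirDeriv_potential_oddExt hk hg (axes_apply_two hi) _ hx).trans
      (dirDeriv_potential_oddExt hk (hg.halfDeriv _) (axes_apply_two hi) hx)
  rw [screenedLaplacian, laplacian_eq_sum_dirDeriv axes (contDiffAt_infty.1 hsmooth 2),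
    Fin.sum_univ_three, htangential 0 (by decide), htangential 1 (by decide)] at heq
  linarith

lemma exists_abs_dirDeriv_normal_potential_oddExt_le (hk : 0 ≤ k) (hg : IsTestOnClosedHalf g)
    (i : Fin 3) :
    ∃ C, ∀ x ∈ openHalf,
      |dirDeriv (axes i) (dirDeriv (axes 2) (potential k (oddExt g))) x| ≤ C := by
  have hpot : ∀ {g}, IsTestOnClosedHalf g → ∃ C, ∀ x, |potential k (oddExt g) x| ≤ C :=
    fun hg => exists_abs_potential_le hk hg.boundedIntegrable_oddExt
  rcases ne_or_eq i 2 with hi | rfl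
  · obtain ⟨C, hC⟩ := exists_lipschitzWith_potential hk
      (hg.halfDeriv (axes i)).boundedIntegrable_oddExt
    refine ⟨C, fun x hx => ?_⟩
    rw [dirDeriv_dirDeriv_potential_oddExt hk hg (axes_apply_two hi) _ hx]
    simpa only [dirDeriv, Real.norm_eq_abs, OrthonormalBasis.norm_eq_one, mul_one] using
      ContinuousLinearMap.le_of_opNorm_le _ (norm_fderiv_le_of_lipschitz ℝ hC) (axes 2)
  · obtain ⟨M, hM⟩ := hg.boundedIntegrable_oddExt.bounded
    obtain ⟨C, hC⟩ := hpot hg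
    obtain ⟨C₀, hC₀⟩ := hpot ((hg.halfDeriv (axes 0)).halfDeriv (axes 0))
    obtain ⟨C₁, hC₁⟩ := hpot ((hg.halfDeriv (axes 1)).halfDeriv (axes 1))
    refine ⟨M + k ^ 2 * C + C₀ + C₁, fun x hx => ?_⟩
    rw [dirDeriv_normal_normal_potential_oddExt hk hg hx]
    beta_reduce
    rw [← oddExt_eqOn g hx]
    refine (abs_add_le _ _).trans (add_le_add ((abs_add_le _ _).trans (add_le_add
      ((abs_add_le _ _).trans (add_le_add (hM x) ?_)) ?_)) ?_)
    · rw [abs_mul, abs_of_nonneg (sq_nonneg k)]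
      exact mul_le_mul_of_nonneg_left (hC x) (sq_nonneg k)
    · simpa using hC₀ x
    · simpa using hC₁ x

lemma contDiffUpTo_zero_dirDeriv_normal_potential_oddExt (hk : 0 ≤ k)
    (hg : IsTestOnClosedHalf g) :
    ContDiffUpTo 0 openHalf (dirDeriv (axes 2) (potential k (oddExt g))) := by
  choose C hC using exists_abs_dirDeriv_normal_potential_oddExt_le hk hg
  refine contDiffUpTo_zero_of_abs_dirDeriv_le axes convex_openHalf (fun x hx => ?_) hC
  have hsmooth := (contDiffAt_potential_oddExt hk hg.boundedIntegrable_oddExt hg.contDiffOn hx).1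
  exact (contDiffAt_dirDeriv (m := 1) (contDiffAt_infty.1 hsmooth 2) one_add_one_eq_two.le _
    ).differentiableAt one_ne_zero

-- The two properties are proved together: one more tangential derivative falls on the density,
-- one more normal derivative of `∂₂ u` is removed by the equation.
lemma contDiffUpTo_potential_oddExt (hk : 0 ≤ k) (n : ℕ) (hg : IsTestOnClosedHalf g) :
    ContDiffUpTo n openHalf (potential k (oddExt g)) ∧
      ContDiffUpTo n openHalf (dirDeriv (axes 2) (potential k (oddExt g))) := by
  have hzero : ∀ {g}, IsTestOnClosedHalf g → ContDiffUpTo 0 openHalf (potential k (oddExt g)) :=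
    fun hg => contDiffUpTo_of_contDiffOn
      (contDiffOn_zero.2 (continuous_potential hk hg.boundedIntegrable_oddExt).continuousOn)
  induction n generalizing g with
  | zero => exact ⟨hzero hg, contDiffUpTo_zero_dirDeriv_normal_potential_oddExt hk hg⟩
  | succ n ih =>
    have hsmooth : ∀ x ∈ openHalf, ContDiffAt ℝ ∞ (potential k (oddExt g)) x := fun x hx =>
      (contDiffAt_potential_oddExt hk hg.boundedIntegrable_oddExt hg.contDiffOn hx).1
    refine ⟨contDiffUpTo_succ_of_dirDeriv axes isOpen_openHalf convex_openHalf (hzero hg)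
        (fun x hx => (hsmooth x hx).differentiableAt (by simp)) fun i => ?_,
      contDiffUpTo_succ_of_dirDeriv axes isOpen_openHalf convex_openHalf
        (contDiffUpTo_zero_dirDeriv_normal_potential_oddExt hk hg) (fun x hx =>
          (contDiffAt_dirDeriv (m := 1) (contDiffAt_infty.1 (hsmooth x hx) 2)
            one_add_one_eq_two.le _).differentiableAt one_ne_zero)
        fun i => ?_⟩
    · rcases ne_or_eq i 2 with hi | rfl
      · exact (ih (hg.halfDeriv _)).1.congr (dirDeriv_potential_oddExt hk hg (axes_apply_two hi))
      · exact (ih hg).2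
    · rcases ne_or_eq i 2 with hi | rfl
      · exact (ih (hg.halfDeriv _)).2.congr
          (dirDeriv_dirDeriv_potential_oddExt hk hg (axes_apply_two hi) _)
      · have hgn : ContDiffUpTo n openHalf g := contDiffUpTo_of_contDiffOn
          (closure_openHalf ▸ contDiffOn_infty.1 hg.contDiffOn n)
        exact (((hgn.add ((ih hg).1.const_mul _)).add
          ((ih ((hg.halfDeriv _).halfDeriv _)).1.const_mul _)).add
          ((ih ((hg.halfDeriv _).halfDeriv _)).1.const_mul _)).congr
          (dirDeriv_normal_normal_potential_oddExt hk hg)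

lemma IsTestOnClosedHalf.contDiffOn_potential_oddExt (hk : 0 ≤ k) (hg : IsTestOnClosedHalf g) :
    ContDiffOn ℝ ∞ (potential k (oddExt g)) closedHalf := by
  rw [← closure_openHalf, contDiffOn_infty]
  exact fun n => (contDiffUpTo_potential_oddExt hk n hg).1.contDiffOn
    (continuous_potential hk hg.boundedIntegrable_oddExt).continuousOn

lemma isTestOnClosedHalf_contDiffBump_mul (χ : ContDiffBump (0 : E3))
    (hg : ContDiffOn ℝ ∞ g closedHalf) : IsTestOnClosedHalf (⇑χ * g) :=
  ⟨χ.contDiff.contDiffOn.mul hg, χ.rOut, fun x _ hx => by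
    rw [Pi.mul_apply, χ.zero_of_le_dist (by simpa using hx), zero_mul]⟩

lemma oddExt_contDiffBump_mul_eqOn (χ : ContDiffBump (0 : E3)) (g : E3 → ℝ) :
    EqOn (oddExt g - oddExt (⇑χ * g)) 0 (ball 0 χ.rIn) := fun x hx => by
  have hone : ∀ z : E3, ‖z‖ = ‖x‖ → χ z = 1 := fun z hz =>
    χ.one_of_mem_closedBall (mem_closedBall_zero_iff.2 (hz ▸ (mem_ball_zero_iff.1 hx).le))
  simp [oddExt, indicator, hone x rfl, hone (reflect x) (reflect.norm_map x)]

lemma contDiffOn_potential_oddExt (hk : 0 ≤ k) (hgi : BoundedIntegrable (oddExt g))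
    (hg : ContDiffOn ℝ ∞ g closedHalf) :
    ContDiffOn ℝ ∞ (potential k (oddExt g)) closedHalf := fun x hx => by
  let χ : ContDiffBump (0 : E3) := ⟨‖x‖ + 1, ‖x‖ + 2, by positivity, by linarith⟩
  have htest : IsTestOnClosedHalf (⇑χ * g) := isTestOnClosedHalf_contDiffBump_mul χ hg
  have hfar := contDiffAt_potential_of_eqOn_zero hk (hgi.sub htest.boundedIntegrable_oddExt)
    (isOpen_ball.mem_nhds (mem_ball_zero_iff.2 (lt_add_one ‖x‖) : x ∈ ball 0 χ.rIn))
    (oddExt_contDiffBump_mul_eqOn χ g)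
  rw [← sub_add_cancel (oddExt g) (oddExt (⇑χ * g)),
    potential_add hk (hgi.sub htest.boundedIntegrable_oddExt) htest.boundedIntegrable_oddExt]
  exact hfar.1.contDiffWithinAt.add (htest.contDiffOn_potential_oddExt hk x hx)

lemma isSmoothDirichletSolution_potential_oddExt (hk : 0 ≤ k) (hgi : BoundedIntegrable (oddExt g))
    (hg : ContDiffOn ℝ ∞ g closedHalf) :
    IsSmoothDirichletSolution (k ^ 2) g (potential k (oddExt g)) where
  smooth := contDiffOn_potential_oddExt hk hgi hg
  equation _ hx := (contDiffAt_potential_oddExt hk hgi hg hx).2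
  boundary _ hx := potential_oddExt_eq_zero k g hx

lemma vanishesLinearly_potential_oddExt (hk : 0 ≤ k) (hgi : BoundedIntegrable (oddExt g)) :
    VanishesLinearly (potential k (oddExt g)) := by
  obtain ⟨C, hC⟩ := exists_lipschitzWith_potential hk hgi
  refine ⟨C, 1, one_pos, fun x (hx : 0 ≤ x 2) _ => ?_⟩
  have hzero := potential_oddExt_eq_zero k g (x := x - x 2 • axes 2) (by simp)
  have hlip := hC.dist_le_mul x (x - x 2 • axes 2)
  rwa [hzero, dist_zero_right, dist_eq_norm, sub_sub_cancel, norm_smul,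
    OrthonormalBasis.norm_eq_one, mul_one, Real.norm_of_nonneg hx] at hlip

end BoundaryRegularity

/-! ### Decay at infinity -/

section PowerWeights

variable {E : Type*} [NormedAddCommGroup E]

lemma inv_mul_rpow_le_add_rpow {a b q : ℝ} (ha : 0 < a) (hb : 0 < b) (hq : 0 ≤ q) :
    a⁻¹ * b ^ (-q) ≤ a ^ (-(q + 1)) + b ^ (-(q + 1)) := by
  have hm : 0 < min a b := lt_min ha hb
  calc a⁻¹ * b ^ (-q) ≤ (min a b)⁻¹ * min a b ^ (-q) :=
        mul_le_mul (inv_anti₀ hm (min_le_left a b))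
          (Real.rpow_le_rpow_of_nonpos hm (min_le_right a b) (neg_nonpos.2 hq))
          (by positivity) (by positivity)
    _ = min a b ^ (-(q + 1)) := by
        rw [neg_add_rev, Real.rpow_add hm, Real.rpow_neg_one]
    _ ≤ a ^ (-(q + 1)) + b ^ (-(q + 1)) := by
        rcases min_choice a b with h | h <;> rw [h]
        · exact le_add_of_nonneg_right (by positivity)
        · exact le_add_of_nonneg_left (by positivity)

lemma inv_norm_mul_rpow_le {q : ℝ} (hq : 0 ≤ q) (w z : E) :
    ‖w‖⁻¹ * (1 + ‖z‖) ^ (-q) ≤ (ball (0 : E) 1).indicator (fun w => ‖w‖⁻¹ ^ 1) w +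
      2 * ((1 + ‖w‖) ^ (-(q + 1)) + (1 + ‖z‖) ^ (-(q + 1))) := by
  have hz : 1 ≤ 1 + ‖z‖ := le_add_of_nonneg_right (norm_nonneg z)
  by_cases hw : w ∈ ball (0 : E) 1
  · rw [indicator_of_mem hw, pow_one]
    refine (mul_le_of_le_one_right (by positivity) ?_).trans
      (le_add_of_nonneg_right (by positivity))
    exact Real.rpow_le_one_of_one_le_of_nonpos hz (neg_nonpos.2 hq)
  · have hw' : 1 ≤ ‖w‖ := by simpa using hw
    have hinv : ‖w‖⁻¹ ≤ 2 * (1 + ‖w‖)⁻¹ := by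
      rw [inv_le_iff_one_le_mul₀ (by positivity)]
      field_simp
      linarith
    rw [indicator_of_notMem hw, zero_add]
    calc ‖w‖⁻¹ * (1 + ‖z‖) ^ (-q) ≤ 2 * ((1 + ‖w‖)⁻¹ * (1 + ‖z‖) ^ (-q)) := by
          rw [← mul_assoc]
          gcongr
      _ ≤ _ := by
          gcongr
          exact inv_mul_rpow_le_add_rpow (by positivity) (by positivity) hq

lemma one_add_norm_rpow_mul_le {s : ℝ} (hs : 0 ≤ s) (w z : E) :
    (1 + ‖w‖) ^ (-s) * (1 + ‖z‖) ^ (-s) ≤ (1 + ‖w + z‖) ^ (-s) := by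
  rw [← Real.mul_rpow (by positivity) (by positivity)]
  refine Real.rpow_le_rpow_of_nonpos (by positivity) ?_ (neg_nonpos.2 hs)
  linarith [norm_add_le w z, mul_nonneg (norm_nonneg w) (norm_nonneg z)]

variable [NormedSpace ℝ E] [MeasureSpace E] [BorelSpace E] [FiniteDimensional ℝ E]
  [(volume : Measure E).IsAddHaarMeasure]

lemma exists_integral_inv_norm_mul_rpow_le {q : ℝ} (hE : 1 < Module.finrank ℝ E)
    (hq : Module.finrank ℝ E < q + 1) :
    ∃ C, ∀ x : E, Integrable (fun z : E => ‖x - z‖⁻¹ * (1 + ‖z‖) ^ (-q)) ∧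
      ∫ z : E, ‖x - z‖⁻¹ * (1 + ‖z‖) ^ (-q) ≤ C := by
  set J : E → ℝ := (ball (0 : E) 1).indicator fun w => ‖w‖⁻¹ ^ 1
  set P : E → ℝ := fun z => (1 + ‖z‖) ^ (-(q + 1))
  have hJ : Integrable J := integrable_indicator_inv_norm_pow hE
  have hP : Integrable P := integrable_one_add_norm hq
  have hq0 : 0 ≤ q := by
    have : (1 : ℝ) < Module.finrank ℝ E := by exact_mod_cast hE
    linarith
  refine ⟨(∫ w, J w) + 2 * ((∫ w, P w) + ∫ w, P w), fun x => ?_⟩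
  have hPx : Integrable fun z => P (x - z) := hP.comp_sub_left x
  have hPP : Integrable fun z => 2 * (P (x - z) + P z) := (hPx.add hP).const_mul 2
  have hbound : Integrable fun z => J (x - z) + 2 * (P (x - z) + P z) :=
    (hJ.comp_sub_left x).add hPP
  have hle : ∀ z, ‖x - z‖⁻¹ * (1 + ‖z‖) ^ (-q) ≤ J (x - z) + 2 * (P (x - z) + P z) :=
    fun z => inv_norm_mul_rpow_le hq0 (x - z) z
  have hint : Integrable fun z : E => ‖x - z‖⁻¹ * (1 + ‖z‖) ^ (-q) :=
    hbound.mono' (Measurable.aestronglyMeasurable (by fun_prop)) (Eventually.of_forall fun z => by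
      rw [Real.norm_of_nonneg (by positivity)]
      exact hle z)
  refine ⟨hint, (integral_mono hint hbound hle).trans_eq ?_⟩
  rw [integral_add (hJ.comp_sub_left x) hPP, integral_const_mul,
    integral_add hPx hP, integral_sub_left_eq_self J, integral_sub_left_eq_self P]

lemma abs_convolution_le_of_abs_le_rpow {s C : ℝ} {H K I : E → ℝ} (hs : 0 ≤ s)
    (hI : Integrable I) (hK : ∀ w, |K w| ≤ I w * (1 + ‖w‖) ^ (-s))
    (hH : ∀ z, |H z| ≤ C * (1 + ‖z‖) ^ (-s)) (x : E) :
    |(H ⋆ K) x| ≤ C * (∫ w, I w) * (1 + ‖x‖) ^ (-s) := by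
  have hC : 0 ≤ C := by simpa using (abs_nonneg _).trans (hH 0)
  have hI0 : ∀ w, 0 ≤ I w := fun w =>
    nonneg_of_mul_nonneg_left ((abs_nonneg _).trans (hK w)) (by positivity)
  rw [convolution_lsmul, ← integral_sub_left_eq_self I volume x, ← integral_const_mul,
    ← integral_mul_const]
  refine norm_integral_le_of_norm_le (f := fun z => H z • K (x - z))
    (((hI.comp_sub_left x).const_mul C).mul_const _) (Eventually.of_forall fun z => ?_)
  calc ‖H z • K (x - z)‖
      ≤ C * (1 + ‖z‖) ^ (-s) * (I (x - z) * (1 + ‖x - z‖) ^ (-s)) := by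
        rw [norm_smul]
        exact mul_le_mul (hH z) (hK _) (norm_nonneg _) (by positivity)
    _ = C * I (x - z) * ((1 + ‖x - z‖) ^ (-s) * (1 + ‖z‖) ^ (-s)) := by ring
    _ ≤ C * I (x - z) * (1 + ‖x‖) ^ (-s) := by
        refine mul_le_mul_of_nonneg_left ?_ (mul_nonneg hC (hI0 _))
        simpa using one_add_norm_rpow_mul_le hs (x - z) z

end PowerWeights

section ExponentialDecay

variable {k s : ℝ}

lemma rpow_le_mul_exp {r : ℝ} (hk : 0 < k) (hs : 0 < s) (hr : 0 ≤ r) :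
    r ^ s ≤ (s / k) ^ s * Real.exp (k * r) := by
  have hlin : r ≤ s / k * Real.exp (k * r / s) := by
    calc r = s / k * (k * r / s) := by field_simp
      _ ≤ s / k * Real.exp (k * r / s) := by
          gcongr
          linarith [Real.add_one_le_exp (k * r / s)]
  calc r ^ s ≤ (s / k * Real.exp (k * r / s)) ^ s := Real.rpow_le_rpow hr hlin hs.le
    _ = (s / k) ^ s * Real.exp (k * r) := by
        rw [Real.mul_rpow (by positivity) (by positivity), ← Real.exp_mul,
          div_mul_cancel₀ _ hs.ne']

lemma exists_abs_yukawa_le_rpow (hk : 0 < k) (hs : 0 < s) :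
    ∃ A, ∀ w : E3, |yukawa k w| ≤ A * ‖w‖⁻¹ * (1 + ‖w‖) ^ (-s) := by
  refine ⟨(s / k) ^ s * Real.exp k, fun w => (abs_yukawa_le k w).trans ?_⟩
  have hexp := rpow_le_mul_exp hk hs (by positivity : 0 ≤ 1 + ‖w‖)
  rw [mul_add, mul_one, Real.exp_add, ← mul_assoc, ← div_le_iff₀ (Real.exp_pos _), div_eq_mul_inv,
    ← Real.exp_neg, ← neg_mul] at hexp
  rw [Real.rpow_neg (by positivity), div_eq_mul_inv, mul_right_comm]
  gcongr
  rwa [← div_eq_mul_inv, le_div_iff₀ (by positivity), mul_comm]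

lemma exists_abs_potential_le_rpow {C : ℝ} {H : E3 → ℝ} (hk : 0 < k) (hs : 0 ≤ s)
    (hH : ∀ z, |H z| ≤ C * (1 + ‖z‖) ^ (-s)) :
    ∃ D, 0 ≤ D ∧ ∀ x, |potential k H x| ≤ D * (1 + ‖x‖) ^ (-s) := by
  obtain ⟨A, hA⟩ := exists_abs_yukawa_le_rpow hk (by positivity : 0 < 4 + s)
  set I : E3 → ℝ := fun w => A * ‖w‖⁻¹ * (1 + ‖w‖) ^ (-4 : ℝ)
  have hweight : BoundedIntegrable fun w : E3 => (1 + ‖w‖) ^ (-4 : ℝ) :=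
    boundedIntegrable_of_abs_le_rpow (C := 1) (p := 4) (by norm_num)
      (Measurable.aestronglyMeasurable (by fun_prop))
      fun w => by rw [one_mul, abs_of_nonneg (by positivity)]
  have hI : Integrable I := by
    refine ((integrable_inv_norm_pow_mul (s := 1) (by simp) hweight 0).const_mul A).congr
      (Eventually.of_forall fun w => ?_)
    simp only [zero_sub, norm_neg, pow_one, I]
    rw [abs_of_nonneg (by positivity), mul_assoc]
  have hK : ∀ w, |yukawa k w| ≤ I w * (1 + ‖w‖) ^ (-s) := fun w => by
    rw [mul_assoc, ← Real.rpow_add (by positivity), ← neg_add]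
    exact hA w
  have hD := abs_convolution_le_of_abs_le_rpow hs hI hK hH
  exact ⟨_, by simpa using (abs_nonneg _).trans (hD 0), hD⟩

end ExponentialDecay

section QuadraticDecay

variable {k p : ℝ} {g : E3 → ℝ} {x z : E3}

lemma abs_yukawa_sub_reflect_le_of_norm_le (hk : 0 ≤ k) (hx : x ≠ 0) (hz : ‖z‖ ≤ ‖x‖ / 2) :
    |yukawa k (x - z) - yukawa k (reflect x - z)| ≤ 8 * ‖z‖ * (‖x‖ ^ 2)⁻¹ := by
  have hx0 : 0 < ‖x‖ := norm_pos_iff.2 hx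
  have hfar : ∀ y : E3, ‖y‖ = ‖x‖ → ‖x‖ / 2 ≤ ‖y - z‖ := fun y hy => by
    linarith [norm_sub_norm_le y z]
  have hv := hfar x rfl
  have hw := hfar (reflect x) (reflect.norm_map x)
  have hdist : |‖x - z‖ - ‖reflect x - z‖| ≤ 2 * ‖z‖ := by
    have hswap : ‖reflect x - z‖ = ‖x - reflect z‖ := by
      rw [← reflect.norm_map (x - reflect z), map_sub, reflect_reflect]
    calc |‖x - z‖ - ‖reflect x - z‖| ≤ ‖reflect z - z‖ := by
          rw [hswap]
          simpa using abs_norm_sub_norm_le (x - z) (x - reflect z)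
      _ ≤ ‖reflect z‖ + ‖z‖ := norm_sub_le _ _
      _ = 2 * ‖z‖ := by rw [reflect.norm_map, two_mul]
  calc |yukawa k (x - z) - yukawa k (reflect x - z)|
      ≤ |‖x - z‖ - ‖reflect x - z‖| * (‖x - z‖⁻¹ * ‖reflect x - z‖⁻¹) :=
        abs_yukawa_sub_le_abs_norm_sub hk (norm_pos_iff.1 (by linarith))
          (norm_pos_iff.1 (by linarith))
    _ ≤ 2 * ‖z‖ * ((‖x‖ / 2)⁻¹ * (‖x‖ / 2)⁻¹) := by gcongr
    _ = 8 * ‖z‖ * (‖x‖ ^ 2)⁻¹ := by field_simp; ring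

lemma abs_yukawa_sub_reflect_mul_rpow_le (hk : 0 ≤ k) (hx : x ≠ 0) :
    |yukawa k (x - z) - yukawa k (reflect x - z)| * (1 + ‖z‖) ^ (-p) ≤
      (‖x‖ ^ 2)⁻¹ * (8 * (1 + ‖z‖) ^ (-(p - 1)) +
        4 * (‖x - z‖⁻¹ * (1 + ‖z‖) ^ (-(p - 2)) + ‖reflect x - z‖⁻¹ * (1 + ‖z‖) ^ (-(p - 2)))) := by
  have hz0 : 0 < 1 + ‖z‖ := by positivity
  rcases le_or_gt ‖z‖ (‖x‖ / 2) with hz | hz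
  · have hweight : ‖z‖ * (1 + ‖z‖) ^ (-p) ≤ (1 + ‖z‖) ^ (-(p - 1)) := by
      rw [neg_sub, sub_eq_add_neg, Real.rpow_add hz0, Real.rpow_one]
      gcongr
      linarith
    calc _ ≤ 8 * ‖z‖ * (‖x‖ ^ 2)⁻¹ * (1 + ‖z‖) ^ (-p) := by
          gcongr
          exact abs_yukawa_sub_reflect_le_of_norm_le hk hx hz
      _ = (‖x‖ ^ 2)⁻¹ * (8 * (‖z‖ * (1 + ‖z‖) ^ (-p))) := by ring
      _ ≤ _ := by
          gcongr
          exact le_add_of_le_of_nonneg (by gcongr) (by positivity)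
  · have hkernel : |yukawa k (x - z) - yukawa k (reflect x - z)| ≤ ‖x - z‖⁻¹ + ‖reflect x - z‖⁻¹ :=
      (abs_sub _ _).trans (add_le_add (by simpa using (weaklySingular_yukawa hk).abs_le (x - z))
        (by simpa using (weaklySingular_yukawa hk).abs_le (reflect x - z)))
    have hweight : (1 + ‖z‖) ^ (-p) ≤ 4 * (‖x‖ ^ 2)⁻¹ * (1 + ‖z‖) ^ (-(p - 2)) := by
      rw [show -p = (-2 : ℝ) + -(p - 2) by ring, Real.rpow_add hz0]
      gcongr
      calc (1 + ‖z‖) ^ (-2 : ℝ) = ((1 + ‖z‖) ^ 2)⁻¹ := by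
            rw [Real.rpow_neg hz0.le, Real.rpow_two]
        _ ≤ ((‖x‖ / 2) ^ 2)⁻¹ := by gcongr; linarith
        _ = 4 * (‖x‖ ^ 2)⁻¹ := by field_simp; norm_num
    calc _ ≤ (‖x - z‖⁻¹ + ‖reflect x - z‖⁻¹) * (4 * (‖x‖ ^ 2)⁻¹ * (1 + ‖z‖) ^ (-(p - 2))) := by
          gcongr
      _ = (‖x‖ ^ 2)⁻¹ * (4 * (‖x - z‖⁻¹ * (1 + ‖z‖) ^ (-(p - 2)) +
            ‖reflect x - z‖⁻¹ * (1 + ‖z‖) ^ (-(p - 2)))) := by ring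
      _ ≤ _ := by
          gcongr
          exact le_add_of_nonneg_left (by positivity)

lemma two_mul_potential_oddExt (hk : 0 ≤ k) (hg : BoundedIntegrable (oddExt g)) (x : E3) :
    2 * potential k (oddExt g) x =
      ∫ z, oddExt g z * (yukawa k (x - z) - yukawa k (reflect x - z)) := by
  have hint := (weaklySingular_yukawa hk).integrable_mul hg
  have hrefl := potential_oddExt_reflect k g x
  simp only [potential, convolution_lsmul, smul_eq_mul] at hrefl ⊢
  simp only [mul_sub]
  rw [integral_sub (hint x) (hint (reflect x)), hrefl]
  ring

lemma exists_abs_potential_oddExt_le_inv_sq {C : ℝ} (hk : 0 ≤ k) (hp : 4 < p)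
    (hg : BoundedIntegrable (oddExt g)) (hC : ∀ z, |oddExt g z| ≤ C * (1 + ‖z‖) ^ (-p)) :
    ∃ D, ∀ x, x ≠ 0 → |potential k (oddExt g) x| ≤ D * (‖x‖ ^ 2)⁻¹ := by
  have hC0 : 0 ≤ C := by simpa using (abs_nonneg _).trans (hC 0)
  obtain ⟨B, hB⟩ := exists_integral_inv_norm_mul_rpow_le (E := E3) (q := p - 2) (by simp)
    (by simp; linarith)
  have hP : Integrable fun z : E3 => (1 + ‖z‖) ^ (-(p - 1)) :=
    integrable_one_add_norm (by simp; linarith)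
  refine ⟨2⁻¹ * (C * (8 * (∫ z : E3, (1 + ‖z‖) ^ (-(p - 1))) + 4 * (B + B))), fun x hx => ?_⟩
  have hW : Integrable fun z : E3 => 4 * (‖x - z‖⁻¹ * (1 + ‖z‖) ^ (-(p - 2)) +
      ‖reflect x - z‖⁻¹ * (1 + ‖z‖) ^ (-(p - 2))) := .const_mul ((hB x).1.add (hB (reflect x)).1) 4
  have hbound : |2 * potential k (oddExt g) x| ≤
      ∫ z, C * ((‖x‖ ^ 2)⁻¹ * (8 * (1 + ‖z‖) ^ (-(p - 1)) + 4 * (‖x - z‖⁻¹ *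
        (1 + ‖z‖) ^ (-(p - 2)) + ‖reflect x - z‖⁻¹ * (1 + ‖z‖) ^ (-(p - 2))))) := by
    rw [two_mul_potential_oddExt hk hg]
    refine norm_integral_le_of_norm_le
      (f := fun z => oddExt g z * (yukawa k (x - z) - yukawa k (reflect x - z)))
      ((((hP.const_mul 8).add hW).const_mul _).const_mul C)
      (Eventually.of_forall fun z => ?_)
    rw [norm_mul, Real.norm_eq_abs, Real.norm_eq_abs, mul_comm]
    calc _ ≤ |yukawa k (x - z) - yukawa k (reflect x - z)| * (C * (1 + ‖z‖) ^ (-p)) := by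
          gcongr
          exact hC z
      _ = C * (|yukawa k (x - z) - yukawa k (reflect x - z)| * (1 + ‖z‖) ^ (-p)) := by ring
      _ ≤ _ := mul_le_mul_of_nonneg_left (abs_yukawa_sub_reflect_mul_rpow_le hk hx) hC0
  simp only [integral_const_mul, integral_add (hP.const_mul 8) hW] at hbound
  rw [integral_add (hB x).1 (hB (reflect x)).1, abs_mul, abs_two] at hbound
  calc |potential k (oddExt g) x|
      ≤ 2⁻¹ * (C * ((‖x‖ ^ 2)⁻¹ * (8 * (∫ z : E3, (1 + ‖z‖) ^ (-(p - 1))) + 4 * (B + B)))) := by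
        rw [← inv_mul_le_iff₀ (by norm_num), inv_inv]
        refine hbound.trans ?_
        gcongr
        exacts [(hB x).2, (hB (reflect x)).2]
    _ = _ := by ring

end QuadraticDecay

lemma one_add_norm_rpow_le_rhoHat_rpow {s s' : ℝ} (hs : 0 ≤ s) (hle : s' ≤ s) (x : E3) :
    (1 + ‖x‖) ^ (-s) ≤ rhoHat x ^ (-s') := by
  have hone : 1 ≤ rhoHat x := Real.one_le_sqrt.2 (le_add_of_nonneg_left (sq_nonneg _))
  have hnorm : rhoHat x ≤ 1 + ‖x‖ :=
    Real.sqrt_le_iff.2 ⟨by positivity, by rw [rho]; nlinarith [norm_nonneg x]⟩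
  calc (1 + ‖x‖) ^ (-s) ≤ rhoHat x ^ (-s) :=
        Real.rpow_le_rpow_of_nonpos (by linarith) hnorm (neg_nonpos.2 hs)
    _ ≤ rhoHat x ^ (-s') := Real.rpow_le_rpow_of_exponent_le hone (neg_le_neg hle)

end HalfSpace

end

open HalfSpace in
theorem mainTheorem6_general {s : ℝ} (hs : 3 < s) (f : E3 → ℝ) (hf : ContDiffOn ℝ ∞ f closedHalf)
    (hdecay : DecaysAtInfinity f s) :
    (4 < s → ∃ u : E3 → ℝ,
      IsSmoothDirichletSolution 0 f u ∧ VanishesLinearly u ∧ DecaysAtInfinity u 2) ∧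
    ∀ t : ℝ, 0 < t → ∃ u : E3 → ℝ,
      IsSmoothDirichletSolution t f u ∧ VanishesLinearly u ∧
        ∃ C : ℝ, ∀ s' ≤ s, ∀ x ∈ closedHalf, |u x| ≤ C * rhoHat x ^ (-s') := by
  have hF := boundedIntegrable_oddExt hs hf.continuousOn hdecay
  obtain ⟨C, hC⟩ := exists_abs_oddExt_le (by linarith) hf.continuousOn hdecay
  refine ⟨fun hs4 => ⟨potential 0 (oddExt f), ?_, vanishesLinearly_potential_oddExt le_rfl hF, ?_⟩,
    fun t ht => ?_⟩
  · simpa using isSmoothDirichletSolution_potential_oddExt le_rfl hF hf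
  · obtain ⟨D, hD⟩ := exists_abs_potential_oddExt_le_inv_sq le_rfl hs4 hF hC
    refine ⟨D, 1, one_pos, fun x _ hx => (hD x (norm_pos_iff.1 (one_pos.trans_le hx))).trans_eq ?_⟩
    rw [rho, Real.rpow_neg (norm_nonneg x), Real.rpow_two]
  · obtain ⟨k, hk, rfl⟩ : ∃ k, 0 < k ∧ k ^ 2 = t := ⟨√t, Real.sqrt_pos.2 ht, Real.sq_sqrt ht.le⟩
    obtain ⟨D, hD0, hD⟩ := exists_abs_potential_le_rpow hk (by linarith) hC
    refine ⟨potential k (oddExt f), isSmoothDirichletSolution_potential_oddExt hk.le hF hf,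
      vanishesLinearly_potential_oddExt hk.le hF, D, fun s' hs' x _ => (hD x).trans ?_⟩
    gcongr
    exact one_add_norm_rpow_le_rhoHat_rpow (by linarith) hs' x

theorem mainTheorem6 (β : ℝ) (hβ : 0 < β) (f : HalfSpace.E3 → ℝ)
    (hf : ContDiffOn ℝ ∞ f HalfSpace.closedHalf)
    (hdecay : HalfSpace.DecaysAtInfinity f (4 + 2 * β)) :
    (∃ u : HalfSpace.E3 → ℝ,
      HalfSpace.IsSmoothDirichletSolution 0 f u ∧
      HalfSpace.VanishesLinearly u ∧
      HalfSpace.DecaysAtInfinity u 2) ∧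
    (∀ t : ℝ, 0 < t → t ≤ 1 →
      ∃ u : HalfSpace.E3 → ℝ,
        HalfSpace.IsSmoothDirichletSolution t f u ∧
        HalfSpace.VanishesLinearly u ∧
        ∃ C : ℝ, ∀ β' : ℝ, β' < β → ∀ x ∈ HalfSpace.closedHalf,
          |u x| ≤ C * HalfSpace.rhoHat x ^ (-(2 + 2 * β'))) := by
  obtain ⟨hzero, hpos⟩ := mainTheorem6_general (by linarith) f hf hdecay
  refine ⟨hzero (by linarith), fun t ht _ => ?_⟩
  obtain ⟨u, hu, hlin, C, hC⟩ := hpos t ht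
  exact ⟨u, hu, hlin, C, fun β' hβ' => hC _ (by linarith)⟩
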